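/- Let $G$ be a finite connected simple graph with vertices $v_1,\dots,v_N$, and let $G^{\varphi}$ be a complex unit gain graph on $G$: to each oriented edge $e_{ij}$ (from $v_i$ to $v_j$, where $v_iv_j\in E(G)$) is assigned a complex number $\varphi(e_{ij})$ of modulus $1$ with $\varphi(e_{ji})=\varphi(e_{ij})^{-1}$. Let $A(G^{\varphi})$ be the Hermitian matrix with $(i,j)$ entry $\varphi(e_{ij})$ if $v_iv_j\in E(G)$ and $0$ otherwise, and let $n(G^{\varphi})$ be the number of its negative eigenvalues, counted with multiplicity. Let $m(\cdot)$ denote the matching number (the number of edges in a maximum matching) of a graph, let $c(G)=|E(G)|-|V(G)|+\omega(G)$ be the cyclomatic number, where $\omega(G)$ is the number of connected components, and let $O(G)$ be the set of vertices of $G$ that lie on cycles. For a cycle $C=u_1u_2\cdots u_ku_1$ of $G$ put $\varphi(C)=\varphi_{u_1u_2}\varphi_{u_2u_3}\cdots\varphi_{u_{k-1}u_k}\varphi_{u_ku_1}$, where $\varphi_{uv}$ is the gain of the oriented edge from $u$ to $v$; the cycle is of Type D if $k$ is odd and $\mathrm{Re}\left((-1)^{(k-1)/2}\varphi(C)\right)<0$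 (this does not depend on the starting vertex or on the direction). If the cycles of $G$ are pairwise vertex-disjoint, let $T_G$ be the graph obtained from $G$ by contracting each cycle to a single vertex. Then $n(G^{\varphi})=m(G)+c(G)$ if and only if the following three conditions all hold: (a) any two distinct cycles of $G$ have no common vertex; (b) every cycle of $G^{\varphi}$ is of Type D; (c) $m(T_G)=m(G-O(G))$. -/

import Mathlib

/-- A complex unit gain graph on the vertex set `V`: a simple graph together with a map from its
oriented edges to the circle group which takes inverse values on opposite orientations. -/
structure UnitGainGraph (V : Type*) where
  graph : SimpleGraph V
  gain : graph.Dart → Circle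
  gain_symm : ∀ d : graph.Dart, gain d.symm = (gain d)⁻¹

namespace SimpleGraph

/-- A subgraph of `G` which is a cycle (of length at least three). Two cycles are the same
if they are equal as subgraphs, whatever the base point and the direction in which
they are traversed. -/
def IsCycleSubgraph {V : Type*} (G : SimpleGraph V) (C : G.Subgraph) : Prop :=
  ∃ (u : V) (p : G.Walk u u), p.IsCycle ∧ p.toSubgraph = C

/-- Any two distinct cycles of `G` have no common vertex. -/
def DisjointCycles {V : Type*} (G : SimpleGraph V) : Prop :=
  ∀ C₁ C₂ : G.Subgraph, G.IsCycleSubgraph C₁ → G.IsCycleSubgraph C₂ → C₁ ≠ C₂ →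
    Disjoint C₁.verts C₂.verts

/-- The set `O(G)` of the vertices of `G` lying on cycles. -/
def cycleVerts {V : Type*} (G : SimpleGraph V) : Set V :=
  {v | ∃ C : G.Subgraph, G.IsCycleSubgraph C ∧ v ∈ C.verts}

/-- The number of edges of a maximum matching (for a finite vertex set). -/
noncomputable def matchingNumber {V : Type*} (G : SimpleGraph V) : ℕ :=
  sSup {k | ∃ M : G.Subgraph, M.IsMatching ∧ M.edgeSet.ncard = k}

/-- The cyclomatic number `|E(G)| - |V(G)| + ω(G)` (for a finite vertex set). -/
noncomputable def cyclomaticNumber {V : Type*} (G : SimpleGraph V) : ℤ :=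
  (G.edgeSet.ncard : ℤ) - (Nat.card V : ℤ) + (Nat.card G.ConnectedComponent : ℤ)

/-- The equivalence relation generated by identifying two vertices whenever they
lie on a common cycle. If the cycles are pairwise vertex-disjoint, its classes are the vertex
sets of the cycles and the singletons of the vertices outside all cycles. -/
def cycleSetoid {V : Type*} (G : SimpleGraph V) : Setoid V :=
  Relation.EqvGen.setoid fun u v =>
    ∃ C : G.Subgraph, G.IsCycleSubgraph C ∧ u ∈ C.verts ∧ v ∈ C.verts

/-- The graph `T_G` obtained from `G` by contracting each cycle into a vertex: distinct
classes are adjacent if some representatives are adjacent in `G`. -/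
def contractCycles {V : Type*} (G : SimpleGraph V) : SimpleGraph (Quotient G.cycleSetoid) :=
  G.map (Quotient.mk G.cycleSetoid)

end SimpleGraph

namespace UnitGainGraph

open Classical in
/-- The adjacency matrix of a complex unit gain graph. -/
noncomputable def adjMatrix {V : Type*} (Φ : UnitGainGraph V) : Matrix V V ℂ :=
  Matrix.of fun u v => if h : Φ.graph.Adj u v then (Φ.gain ⟨(u, v), h⟩ : ℂ) else 0

theorem isHermitian_adjMatrix {V : Type*} (Φ : UnitGainGraph V) : Φ.adjMatrix.IsHermitian := by
  ext u v
  by_cases h : Φ.graph.Adj v u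
  · have key := Φ.gain_symm ⟨(v, u), h⟩
    have e : (⟨(v, u), h⟩ : Φ.graph.Dart).symm = ⟨(u, v), h.symm⟩ := rfl
    rw [e] at key
    simp [adjMatrix, Matrix.conjTranspose_apply, h, h.symm, key, Circle.coe_inv_eq_conj, -Circle.coe_inv]
  · have h2 : ¬ Φ.graph.Adj u v := fun h3 => h h3.symm
    simp [adjMatrix, Matrix.conjTranspose_apply, h, h2]

open Classical in
/-- The negative inertia index: the number of negative eigenvalues of the adjacency matrix,
counted with multiplicity. -/
noncomputable def negInertia {V : Type*} [Fintype V] (Φ : UnitGainGraph V) : ℕ :=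
  Fintype.card {i : V // Φ.isHermitian_adjMatrix.eigenvalues i < 0}

/-- The gain `φ(v₁v₂) φ(v₂v₃) ⋯` of a walk. -/
noncomputable def walkGain {V : Type*} (Φ : UnitGainGraph V) {u v : V}
    (p : Φ.graph.Walk u v) : ℂ :=
  ((p.darts.map Φ.gain).prod : Circle)

/-- A cycle of Type D, traversed by the closed walk `p`. The condition does not depend on the
base point, nor on the direction, since reversal conjugates the gain. -/
def IsTypeD {V : Type*} (Φ : UnitGainGraph V) {u : V} (p : Φ.graph.Walk u u) : Prop :=
  Odd p.length ∧ ((-1 : ℂ) ^ ((p.length - 1) / 2) * Φ.walkGain p).re < 0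

end UnitGainGraph

/-! Deleting a vertex changes the negative inertia index `n` by at most one. Deleting vertices on
cycles until a forest remains, which a König cover bounds, gives `n ≤ m + c`; when two cycles meet,
a common vertex can be chosen whose deletion lowers `c` by at least two, so equality forces the
cycles to be disjoint. Equality then survives the removal of leaves with their neighbours, and of
leaf cycles of the contracted graph; this induction shows that every cycle is of Type D and that
some maximum matching never joins a cycle to the rest of the graph. Conversely, if
`m(T_G) = m(G - O(G))`, a minimum König cover of `T_G` gives vertices off the cycles, matched to
further such vertices, which meet all bridges. Eliminating the matched pairs one at a time lowers
`n` each time, and what is left is a disjoint union of cycles, where a cycle of Type D of length `k`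
has `n = (k + 1) / 2`. -/

namespace UnitGainGraph

open SimpleGraph Matrix Module

section NegativeIndex

variable {𝕜 V W E : Type*} [RCLike 𝕜] [Fintype V] [Fintype W]

/-- The real quadratic form `z ↦ z* A z` of a Hermitian matrix; for other matrices this is the form
of the Hermitian part. -/
def hermForm (A : Matrix V V 𝕜) (z : V → 𝕜) : ℝ := RCLike.re (star z ⬝ᵥ A *ᵥ z)

/-- The form of `A` is negative definite on the subspace `U`. -/
def IsNegDefOn (A : Matrix V V 𝕜) (U : Submodule 𝕜 (V → 𝕜)) : Prop :=
  ∀ z ∈ U, z ≠ 0 → hermForm A z < 0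

/-- The negative inertia index of a Hermitian matrix, encoded as the largest dimension of a
subspace on which its form is negative definite. -/
noncomputable def negIndex (A : Matrix V V 𝕜) : ℕ :=
  sSup {k | ∃ U : Submodule 𝕜 (V → 𝕜), IsNegDefOn A U ∧ finrank 𝕜 U = k}

@[simp] lemma hermForm_zero (A : Matrix V V 𝕜) : hermForm A 0 = 0 := by simp [hermForm]

lemma bddAbove_finrank_isNegDefOn (A : Matrix V V 𝕜) :
    BddAbove {k | ∃ U : Submodule 𝕜 (V → 𝕜), IsNegDefOn A U ∧ finrank 𝕜 U = k} := by
  refine ⟨finrank 𝕜 (V → 𝕜), ?_⟩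
  rintro _ ⟨U, -, rfl⟩
  exact Submodule.finrank_le U

lemma exists_isNegDefOn_finrank_eq (A : Matrix V V 𝕜) :
    ∃ U : Submodule 𝕜 (V → 𝕜), IsNegDefOn A U ∧ finrank 𝕜 U = negIndex A :=
  Nat.sSup_mem (s := {k | ∃ U : Submodule 𝕜 (V → 𝕜), IsNegDefOn A U ∧ finrank 𝕜 U = k})
    ⟨0, ⊥, fun _ hz hz0 => absurd ((Submodule.mem_bot 𝕜).1 hz) hz0, finrank_bot 𝕜 _⟩
    (bddAbove_finrank_isNegDefOn A)

lemma finrank_le_negIndex [AddCommGroup E] [Module 𝕜 E] {A : Matrix V V 𝕜}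
    (f : E →ₗ[𝕜] (V → 𝕜)) (hf : ∀ z, z ≠ 0 → hermForm A (f z) < 0) :
    finrank 𝕜 E ≤ negIndex A := by
  have hinj : Function.Injective f := (injective_iff_map_eq_zero f).2 fun z hz => by
    by_contra hz0
    simpa [hz] using hf z hz0
  rw [← LinearMap.finrank_range_of_inj hinj]
  refine le_csSup (bddAbove_finrank_isNegDefOn A) ⟨LinearMap.range f, ?_, rfl⟩
  rintro _ ⟨z, rfl⟩ hz
  exact hf z fun h => hz (by rw [h, map_zero])

lemma negIndex_le_of_forall_hermForm_neg {A : Matrix V V 𝕜} {B : Matrix W W 𝕜}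
    (f : (V → 𝕜) →ₗ[𝕜] (W → 𝕜)) (hf : ∀ z, hermForm A z < 0 → hermForm B (f z) < 0) :
    negIndex A ≤ negIndex B := by
  obtain ⟨U, hU, hrank⟩ := exists_isNegDefOn_finrank_eq A
  rw [← hrank]
  exact finrank_le_negIndex (f ∘ₗ U.subtype) fun z hz => hf _ (hU z z.2 (by simpa using hz))

lemma hermForm_conjTranspose_mul_mul (A : Matrix W W 𝕜) (P : Matrix W V 𝕜) (z : V → 𝕜) :
    hermForm (Pᴴ * A * P) z = hermForm A (P *ᵥ z) := by
  simp only [hermForm, star_mulVec, ← mulVec_mulVec, ← dotProduct_mulVec]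

lemma negIndex_conjTranspose_mul_mul_le (A : Matrix W W 𝕜) (P : Matrix W V 𝕜) :
    negIndex (Pᴴ * A * P) ≤ negIndex A :=
  negIndex_le_of_forall_hermForm_neg P.mulVecLin fun z hz => by
    rwa [mulVecLin_apply, ← hermForm_conjTranspose_mul_mul]

lemma negIndex_le_add_finrank [AddCommGroup E] [Module 𝕜 E] [FiniteDimensional 𝕜 E]
    {A B : Matrix V V 𝕜} (f : (V → 𝕜) →ₗ[𝕜] E)
    (h : ∀ z, f z = 0 → hermForm B z = hermForm A z) :
    negIndex A ≤ negIndex B + finrank 𝕜 E := by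
  obtain ⟨U, hU, hrank⟩ := exists_isNegDefOn_finrank_eq A
  let g : U →ₗ[𝕜] E := f ∘ₗ U.subtype
  have hker : finrank 𝕜 (LinearMap.ker g) ≤ negIndex B := by
    refine finrank_le_negIndex (E := LinearMap.ker g) (U.subtype.domRestrict _) fun z hz => ?_
    have hz0 : (z : V → 𝕜) ≠ 0 := by simpa using hz
    exact (h z z.2).trans_lt (hU z z.1.2 hz0)
  have hrange : finrank 𝕜 (LinearMap.range g) ≤ finrank 𝕜 E := Submodule.finrank_le _
  rw [← hrank, ← g.finrank_range_add_finrank_ker]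
  lia

lemma star_dotProduct_mulVec_comm {A : Matrix V V 𝕜} (hA : A.IsHermitian) (x y : V → 𝕜) :
    star x ⬝ᵥ A *ᵥ y = star (star y ⬝ᵥ A *ᵥ x) := by
  rw [star_dotProduct, star_mulVec, hA.eq, ← dotProduct_mulVec]

lemma hermForm_add_smul {A : Matrix V V 𝕜} (hA : A.IsHermitian) {x g : V → 𝕜}
    (hxg : star x ⬝ᵥ A *ᵥ g = 0) (c : 𝕜) :
    hermForm A (x + c • g) = hermForm A x + ‖c‖ ^ 2 * hermForm A g := by
  have hgx : star g ⬝ᵥ A *ᵥ x = 0 := by rw [star_dotProduct_mulVec_comm hA, hxg, star_zero]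
  have hc : star c * c = ((‖c‖ ^ 2 : ℝ) : 𝕜) := by simpa using RCLike.conj_mul c
  simp only [hermForm, star_add, star_smul, mulVec_add, mulVec_smul, add_dotProduct,
    dotProduct_add, smul_dotProduct, dotProduct_smul, hxg, hgx, smul_eq_mul, mul_zero, add_zero,
    zero_add, ← mul_assoc, map_add]
  rw [mul_comm c, hc, RCLike.re_ofReal_mul]

lemma negIndex_add_one_le_of_orthogonal {A : Matrix V V 𝕜} {B : Matrix W W 𝕜}
    (hA : A.IsHermitian) (f : (W → 𝕜) →ₗ[𝕜] (V → 𝕜)) (g : V → 𝕜)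
    (hf : ∀ z, hermForm A (f z) = hermForm B z) (hg : hermForm A g < 0)
    (hfg : ∀ z, star (f z) ⬝ᵥ A *ᵥ g = 0) : negIndex B + 1 ≤ negIndex A := by
  obtain ⟨U, hU, hrank⟩ := exists_isNegDefOn_finrank_eq B
  rw [← hrank, ← finrank_self 𝕜, ← finrank_prod]
  refine finrank_le_negIndex ((f ∘ₗ U.subtype).coprod (LinearMap.toSpanSingleton 𝕜 _ g)) ?_
  rintro ⟨z, c⟩ hzc
  suffices hermForm A (f z + c • g) < 0 by simpa using this
  rw [hermForm_add_smul hA (hfg z), hf]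
  by_cases hz : z = 0
  · have hc : c ≠ 0 := fun hc => hzc (by rw [hz, hc, Prod.mk_zero_zero])
    simpa [hz] using mul_neg_of_pos_of_neg (pow_pos (norm_pos_iff.2 hc) 2) hg
  · have hzneg := hU z z.2 (by simpa using hz)
    nlinarith [sq_nonneg ‖c‖]

open Classical in
/-- The matrix obtained from `A` by replacing the rows and columns indexed by `S` by zero. -/
noncomputable def zeroOn (A : Matrix V V 𝕜) (S : Set V) : Matrix V V 𝕜 :=
  (diagonal (Sᶜ.indicator 1))ᴴ * A * diagonal (Sᶜ.indicator 1)

open Classical in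
lemma zeroOn_apply (A : Matrix V V 𝕜) (S : Set V) (i j : V) :
    zeroOn A S i j = if i ∈ S ∨ j ∈ S then 0 else A i j := by
  by_cases hi : i ∈ S <;> by_cases hj : j ∈ S <;>
    simp [zeroOn, diagonal_conjTranspose, hi, hj]

open Classical in
lemma hermForm_zeroOn (A : Matrix V V 𝕜) (S : Set V) (z : V → 𝕜) :
    hermForm (zeroOn A S) z = hermForm A (diagonal (Sᶜ.indicator 1) *ᵥ z) :=
  hermForm_conjTranspose_mul_mul _ _ z

lemma hermForm_zeroOn_of_eq_zero (A : Matrix V V 𝕜) {S : Set V} {z : V → 𝕜}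
    (hz : ∀ v ∈ S, z v = 0) : hermForm (zeroOn A S) z = hermForm A z := by
  classical
  rw [hermForm_zeroOn]
  congr 1
  ext v
  by_cases hv : v ∈ S <;> simp [mulVec_diagonal, hv, hz]

lemma negIndex_zeroOn_le (A : Matrix V V 𝕜) (S : Set V) : negIndex (zeroOn A S) ≤ negIndex A :=
  negIndex_conjTranspose_mul_mul_le _ _

lemma negIndex_le_negIndex_zeroOn_add_ncard (A : Matrix V V 𝕜) (S : Set V) :
    negIndex A ≤ negIndex (zeroOn A S) + S.ncard := by
  classical
  rw [← Nat.card_coe_set_eq, Nat.card_eq_fintype_card, ← finrank_fintype_fun_eq_card 𝕜]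
  exact negIndex_le_add_finrank (LinearMap.funLeft 𝕜 𝕜 (Subtype.val : S → V)) fun z hz =>
    hermForm_zeroOn_of_eq_zero A fun v hv => congrFun hz ⟨v, hv⟩

lemma star_dotProduct_mulVec_eq_zero {A : Matrix V V 𝕜} {v : V} {g z : V → 𝕜}
    (hg : ∀ w, w ≠ v → (A *ᵥ g) w = 0) (hz : z v = 0) : star z ⬝ᵥ A *ᵥ g = 0 :=
  Finset.sum_eq_zero fun w _ => by
    obtain rfl | hw := eq_or_ne w v
    · simp [hz]
    · rw [hg w hw, mul_zero]

lemma negIndex_zeroOn_singleton_add_one_le {A : Matrix V V 𝕜} (hA : A.IsHermitian) {v : V}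
    {g : V → 𝕜} (hg : ∀ w, w ≠ v → (A *ᵥ g) w = 0) (hneg : hermForm A g < 0) :
    negIndex (zeroOn A {v}) + 1 ≤ negIndex A := by
  classical
  exact negIndex_add_one_le_of_orthogonal hA (diagonal (({v} : Set V)ᶜ.indicator 1)).mulVecLin g
    (fun z => (hermForm_zeroOn A {v} z).symm) hneg
    fun z => star_dotProduct_mulVec_eq_zero hg (by simp [mulVec_diagonal])

lemma negIndex_le_negIndex_zeroOn_singleton {A : Matrix V V 𝕜} (hA : A.IsHermitian) {v : V}
    {g : V → 𝕜} (hgv : g v = 1) (hg : ∀ w, w ≠ v → (A *ᵥ g) w = 0) (hnonneg : 0 ≤ hermForm A g) :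
    negIndex A ≤ negIndex (zeroOn A {v}) := by
  refine negIndex_le_of_forall_hermForm_neg
    (LinearMap.id - (LinearMap.proj (R := 𝕜) (φ := fun _ : V => 𝕜) v).smulRight g) fun z hz => ?_
  change hermForm _ (z - z v • g) < 0
  have hv : (z - z v • g) v = 0 := by simp [hgv]
  rw [hermForm_zeroOn_of_eq_zero A (by rintro _ rfl; exact hv)]
  have hsplit := hermForm_add_smul hA (star_dotProduct_mulVec_eq_zero hg hv) (z v)
  rw [sub_add_cancel] at hsplit
  nlinarith [sq_nonneg ‖z v‖]

lemma mulVec_apply_of_forall_ne {A : Matrix V V 𝕜} {x y : V} (hx : ∀ w, w ≠ y → A x w = 0)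
    (z : V → 𝕜) : (A *ᵥ z) x = A x y * z y :=
  Finset.sum_eq_single y (fun w _ hw => mul_eq_zero_of_left (hx w hw) _) (by simp)

open Classical in
lemma hermForm_add_smul_single {A : Matrix V V 𝕜} (hA : A.IsHermitian) {x y : V} (hxy : x ≠ y)
    (hx : ∀ w, w ≠ y → A x w = 0) {z : V → 𝕜} (hz : z y = 0) (c : 𝕜) :
    hermForm A (z + c • Pi.single x 1) = hermForm A z := by
  have hcol : ∀ w, w ≠ y → (A *ᵥ Pi.single x 1) w = 0 := fun w hw => by
    rw [mulVec_single_one, col_apply, ← hA.apply, hx w hw, star_zero]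
  have hsingle : hermForm A (Pi.single x 1) = 0 := by
    rw [hermForm, star_dotProduct_mulVec_eq_zero hcol (by simp [hxy.symm]), map_zero]
  rw [hermForm_add_smul hA (star_dotProduct_mulVec_eq_zero hcol hz), hsingle, mul_zero, add_zero]

open Classical in
/-- The negative direction is `e_y - A x y • e_x`; a vector `z` vanishing at `y` is moved along
`e_x`, without changing its form, until it is orthogonal to that direction. -/
lemma negIndex_zeroOn_singleton_add_one_le_of_pendant {A : Matrix V V 𝕜} (hA : A.IsHermitian)
    {x y : V} (hxy : x ≠ y) (hx : ∀ w, w ≠ y → A x w = 0) (hyy : A y y = 0) (hne : A x y ≠ 0) :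
    negIndex (zeroOn A {y}) + 1 ≤ negIndex A := by
  have hyx : A y x = star (A x y) := (hA.apply y x).symm
  have hyx0 : A y x ≠ 0 := by simpa [hyx] using hne
  let D : Matrix V V 𝕜 := diagonal (({y} : Set V)ᶜ.indicator 1)
  let c : (V → 𝕜) →ₗ[𝕜] 𝕜 := -(A y x)⁻¹ • LinearMap.proj y ∘ₗ (A * D).mulVecLin
  let f : (V → 𝕜) →ₗ[𝕜] (V → 𝕜) := D.mulVecLin + c.smulRight (Pi.single x 1)
  let g : V → 𝕜 := Pi.single y 1 - A x y • Pi.single x 1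
  have hDy (z) : (D *ᵥ z) y = 0 := by simp [D, mulVec_diagonal]
  have hfy (z) : f z y = 0 := by simp [f, hDy, hxy.symm]
  have hstar_g (w : V → 𝕜) : star g ⬝ᵥ w = w y - star (A x y) * w x := by
    simp [g, sub_dotProduct]
  refine negIndex_add_one_le_of_orthogonal hA f g (fun z => ?_) ?_ fun z => ?_
  · rw [hermForm_zeroOn]
    exact hermForm_add_smul_single hA hxy hx (hDy z) (c z)
  · have hxg : (A *ᵥ g) x = A x y := by
      rw [mulVec_apply_of_forall_ne hx]
      simp [g, hxy.symm]
    have hyg : (A *ᵥ g) y = -(star (A x y) * A x y) := by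
      simp [g, mulVec_sub, mulVec_smul, hyy, hyx, mul_comm]
    have hnorm : star (A x y) * A x y = ((‖A x y‖ ^ 2 : ℝ) : 𝕜) := by
      simpa using RCLike.conj_mul (A x y)
    rw [hermForm, hstar_g, hxg, hyg, hnorm, map_sub, map_neg, RCLike.ofReal_re]
    nlinarith [norm_pos_iff.2 hne]
  · have hAfy : (A *ᵥ f z) y = 0 := by
      have hfz : f z = D *ᵥ z + (-(A y x)⁻¹ * (A *ᵥ D *ᵥ z) y) • Pi.single x 1 := by
        simp [f, c]
      rw [hfz, mulVec_add, mulVec_smul, mulVec_single_one]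
      simp [hyx0, mul_right_comm]
    rw [star_dotProduct_mulVec_comm hA, hstar_g, hAfy, mulVec_apply_of_forall_ne hx, hfy]
    simp

lemma hermForm_diagonal [DecidableEq V] (d : V → ℝ) (z : V → 𝕜) :
    hermForm (diagonal fun i => (d i : 𝕜)) z = ∑ i, d i * ‖z i‖ ^ 2 := by
  simp only [hermForm, dotProduct, mulVec_diagonal, map_sum, Pi.star_apply]
  refine Finset.sum_congr rfl fun i _ => ?_
  rw [mul_left_comm, RCLike.re_ofReal_mul, RCLike.star_def, RCLike.conj_mul]
  norm_cast

lemma negIndex_diagonal [DecidableEq V] (d : V → ℝ) :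
    negIndex (diagonal fun i => (d i : 𝕜)) = Fintype.card {i : V // d i < 0} := by
  rw [← finrank_fintype_fun_eq_card 𝕜]
  apply le_antisymm
  · obtain ⟨U, hU, hrank⟩ := exists_isNegDefOn_finrank_eq (diagonal fun i => (d i : 𝕜))
    rw [← hrank]
    let f : U →ₗ[𝕜] ({i : V // d i < 0} → 𝕜) := LinearMap.funLeft 𝕜 𝕜 Subtype.val ∘ₗ U.subtype
    refine LinearMap.finrank_le_finrank_of_injective (f := f)
      ((injective_iff_map_eq_zero f).2 fun z hz => ?_)
    by_contra hz0
    refine (hU z z.2 (by simpa using hz0)).not_ge ?_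
    rw [hermForm_diagonal]
    refine Finset.sum_nonneg fun i _ => ?_
    by_cases hi : d i < 0
    · have hzi : (z : V → 𝕜) i = 0 := congrFun hz ⟨i, hi⟩
      simp [hzi]
    · exact mul_nonneg (not_lt.1 hi) (sq_nonneg _)
  · let f := Function.ExtendByZero.linearMap 𝕜 (Subtype.val : {i : V // d i < 0} → V)
    have hf_coe (z) (i : {i : V // d i < 0}) : f z i = z i :=
      Subtype.val_injective.extend_apply _ _ _
    have hf_zero (z) (i : V) (hi : ¬ d i < 0) : f z i = 0 :=
      Function.extend_apply' _ _ _ (by rintro ⟨a, rfl⟩; exact hi a.2)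
    refine finrank_le_negIndex f fun z hz => ?_
    obtain ⟨j, hj⟩ := Function.ne_iff.1 hz
    rw [hermForm_diagonal]
    refine Finset.sum_neg' (fun i _ => ?_) ⟨j, Finset.mem_univ _, ?_⟩
    · by_cases hi : d i < 0
      · exact mul_nonpos_of_nonpos_of_nonneg hi.le (sq_nonneg _)
      · simp [hf_zero z i hi]
    · rw [hf_coe]
      exact mul_neg_of_neg_of_pos j.2 (pow_pos (norm_pos_iff.2 hj) 2)

lemma negIndex_eq_card_eigenvalues_neg [DecidableEq V] {A : Matrix V V 𝕜} (hA : A.IsHermitian) :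
    negIndex A = Fintype.card {i : V // hA.eigenvalues i < 0} := by
  rw [← negIndex_diagonal (𝕜 := 𝕜)]
  let U : Matrix V V 𝕜 := hA.eigenvectorUnitary
  have hdiag : diagonal (fun i => (hA.eigenvalues i : 𝕜)) = Uᴴ * A * U :=
    hA.conjStarAlgAut_star_eigenvectorUnitary.symm.trans
      (Unitary.conjStarAlgAut_star_apply _ _)
  have hspec : A = Uᴴᴴ * diagonal (fun i => (hA.eigenvalues i : 𝕜)) * Uᴴ := by
    rw [conjTranspose_conjTranspose]
    exact hA.spectral_theorem
  apply le_antisymm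
  · conv_lhs => rw [hspec]
    exact negIndex_conjTranspose_mul_mul_le _ _
  · rw [hdiag]
    exact negIndex_conjTranspose_mul_mul_le _ _

end NegativeIndex

section Isolate

variable {V : Type*} {G H : SimpleGraph V}

/-- The graph `G - S`, kept on the vertex set of `G`: the edges meeting `S` are deleted, so that the
vertices in `S` become isolated. -/
def isolate (G : SimpleGraph V) (S : Set V) : SimpleGraph V where
  Adj u v := G.Adj u v ∧ u ∉ S ∧ v ∉ S
  symm.symm _ _ h := ⟨h.1.symm, h.2.2, h.2.1⟩
  loopless.irrefl _ h := h.1.ne rfl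

@[simp] lemma isolate_adj {S : Set V} {u v : V} :
    (isolate G S).Adj u v ↔ G.Adj u v ∧ u ∉ S ∧ v ∉ S := Iff.rfl

lemma isolate_le (S : Set V) : isolate G S ≤ G := fun _ _ h => h.1

lemma isolate_eq_self {S : Set V} (h : ∀ x ∈ S, ∀ z, ¬ G.Adj x z) : isolate G S = G :=
  (isolate_le S).antisymm fun x z hxz => ⟨hxz, fun hx => h x hx z hxz, fun hz => h z hz x hxz.symm⟩

lemma isolate_isolate (S T : Set V) : isolate (isolate G S) T = isolate G (S ∪ T) := by
  ext u v
  simp only [isolate_adj, Set.mem_union]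
  tauto

lemma isolate_mono (h : H ≤ G) {S T : Set V} (hST : S ⊆ T) : isolate H T ≤ isolate G S :=
  fun _ _ hadj => ⟨h hadj.1, fun hS => hadj.2.1 (hST hS), fun hS => hadj.2.2 (hST hS)⟩

lemma isolate_lt {S : Set V} {u v : V} (h : G.Adj u v) (hu : u ∈ S) : isolate G S < G :=
  (isolate_le S).lt_of_ne fun heq => by
    rw [← heq] at h
    exact h.2.1 hu

lemma deleteEdges_singleton_lt {e : Sym2 V} (he : e ∈ G.edgeSet) : G.deleteEdges {e} < G :=
  (deleteEdges_le _).lt_of_ne fun heq => by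
    rw [← heq, edgeSet_deleteEdges] at he
    exact he.2 rfl

lemma le_deleteEdges_singleton (h : H ≤ G) {e : Sym2 V} (he : e ∉ H.edgeSet) :
    H ≤ G.deleteEdges {e} := fun a b hab =>
  deleteEdges_adj.2 ⟨h hab, by rintro rfl; exact he hab⟩

lemma isolate_le_deleteEdges {S : Set V} {x y : V} (hx : x ∈ S) :
    isolate G S ≤ G.deleteEdges {s(x, y)} :=
  le_deleteEdges_singleton (isolate_le S) fun h => h.2.1 hx

end Isolate

section Cycles

variable {V : Type*} {G H : SimpleGraph V}

lemma exists_mem_edges_of_isCycle {u x : V} {p : G.Walk u u} (hp : p.IsCycle)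
    (hx : x ∈ p.support) : ∃ y, s(x, y) ∈ p.edges := by
  obtain ⟨e, he, hxe⟩ := (Walk.mem_support_iff_exists_mem_edges_of_not_nil hp.not_nil).1 hx
  obtain ⟨y, rfl⟩ := hxe
  exact ⟨y, he⟩

lemma exists_isCycle_of_not_isBridge {e : Sym2 V} (he : e ∈ G.edgeSet) (h : ¬ G.IsBridge e) :
    ∃ (u : V) (p : G.Walk u u), p.IsCycle ∧ e ∈ p.edges := by
  rw [isBridge_iff_forall_cycle_notMem he] at h
  push Not at h
  exact h

lemma not_isBridge_of_mem_edges {u : V} {p : G.Walk u u} (hp : p.IsCycle) {e : Sym2 V}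
    (he : e ∈ p.edges) : ¬ G.IsBridge e := fun h => h.notMem_edges_of_isCycle hp he

lemma edges_subset_edgeSet_isolate {u v : V} (p : G.Walk u v) {S : Set V}
    (h : ∀ x ∈ p.support, x ∉ S) : ∀ e ∈ p.edges, e ∈ (isolate G S).edgeSet := by
  rintro ⟨a, b⟩ he
  exact ⟨p.adj_of_mem_edges he, h a (p.fst_mem_support_of_mem_edges he),
    h b (p.snd_mem_support_of_mem_edges he)⟩

lemma support_subset_of_edges_subset {u v : V} {p : G.Walk u u} {q : G.Walk v v} (hp : p.IsCycle)
    (h : ∀ e ∈ p.edges, e ∈ q.edges) : ∀ x ∈ p.support, x ∈ q.support := by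
  intro x hx
  obtain ⟨y, hxy⟩ := exists_mem_edges_of_isCycle hp hx
  exact q.fst_mem_support_of_mem_edges (h _ hxy)

lemma disjointCycles_iff :
    G.DisjointCycles ↔ ∀ ⦃u v : V⦄ (p : G.Walk u u) (q : G.Walk v v), p.IsCycle → q.IsCycle →
      ∀ x ∈ p.support, x ∈ q.support → ∀ e ∈ p.edges, e ∈ q.edges := by
  constructor
  · intro h u v p q hp hq x hxp hxq e he
    have heq : p.toSubgraph = q.toSubgraph := by
      by_contra hne
      exact Set.disjoint_left.1 (h _ _ ⟨u, p, hp, rfl⟩ ⟨v, q, hq, rfl⟩ hne)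
        (p.mem_verts_toSubgraph.2 hxp) (q.mem_verts_toSubgraph.2 hxq)
    rwa [← Walk.mem_edges_toSubgraph, ← heq, Walk.mem_edges_toSubgraph]
  · rintro h _ _ ⟨u, p, hp, rfl⟩ ⟨v, q, hq, rfl⟩ hne
    refine Set.disjoint_left.2 fun x hxp hxq => hne ?_
    rw [Walk.mem_verts_toSubgraph] at hxp hxq
    have hpq := h p q hp hq x hxp hxq
    have hqp := h q p hq hp x hxq hxp
    ext a b
    · simp only [Walk.mem_verts_toSubgraph]
      exact ⟨support_subset_of_edges_subset hp hpq a, support_subset_of_edges_subset hq hqp a⟩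
    · simp only [Walk.adj_toSubgraph_iff_mem_edges]
      exact ⟨hpq _, hqp _⟩

lemma disjointCycles_anti (h : H ≤ G) (hG : G.DisjointCycles) : H.DisjointCycles := by
  rw [disjointCycles_iff] at hG ⊢
  intro u v p q hp hq x hxp hxq e he
  have he' := hG (p.mapLe h) (q.mapLe h) ((Walk.isCycle_mapLe h).2 hp)
    ((Walk.isCycle_mapLe h).2 hq) x (by simpa using hxp) (by simpa using hxq) e (by simpa using he)
  simpa using he'

lemma mem_cycleVerts_iff {x : V} :
    x ∈ G.cycleVerts ↔ ∃ (u : V) (p : G.Walk u u), p.IsCycle ∧ x ∈ p.support := by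
  constructor
  · rintro ⟨_, ⟨u, p, hp, rfl⟩, hx⟩
    exact ⟨u, p, hp, p.mem_verts_toSubgraph.1 hx⟩
  · rintro ⟨u, p, hp, hx⟩
    exact ⟨_, ⟨u, p, hp, rfl⟩, p.mem_verts_toSubgraph.2 hx⟩

lemma cycleVerts_mono (h : H ≤ G) : H.cycleVerts ⊆ G.cycleVerts := by
  intro x hx
  obtain ⟨u, p, hp, hxp⟩ := mem_cycleVerts_iff.1 hx
  exact mem_cycleVerts_iff.2 ⟨u, p.mapLe h, (Walk.isCycle_mapLe h).2 hp, by simpa using hxp⟩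

lemma isBridge_of_notMem_cycleVerts {x y : V} (hxy : G.Adj x y) (hx : x ∉ G.cycleVerts) :
    G.IsBridge s(x, y) := by
  by_contra h
  obtain ⟨u, p, hp, he⟩ := exists_isCycle_of_not_isBridge hxy h
  exact hx (mem_cycleVerts_iff.2 ⟨u, p, hp, p.fst_mem_support_of_mem_edges he⟩)

/-- The graph formed by the edges of `G` that lie on cycles. -/
def cyclePart (G : SimpleGraph V) : SimpleGraph V := G.deleteEdges {e | G.IsBridge e}

lemma cyclePart_le : cyclePart G ≤ G := deleteEdges_le _

lemma cyclePart_adj {u v : V} : (cyclePart G).Adj u v ↔ G.Adj u v ∧ ¬ G.IsBridge s(u, v) :=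
  deleteEdges_adj

lemma cyclePart_mono (h : H ≤ G) : cyclePart H ≤ cyclePart G := fun _ _ hadj => by
  rw [cyclePart_adj] at hadj ⊢
  exact ⟨h hadj.1, fun hb => hadj.2 (hb.anti h)⟩

lemma edges_subset_edgeSet_cyclePart {u : V} {p : G.Walk u u} (hp : p.IsCycle) :
    ∀ e ∈ p.edges, e ∈ (cyclePart G).edgeSet := by
  rintro ⟨a, b⟩ he
  exact cyclePart_adj.2 ⟨p.adj_of_mem_edges he, not_isBridge_of_mem_edges hp he⟩

end Cycles

section Cyclomatic

variable {V : Type*} {G H : SimpleGraph V}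

lemma eq_of_reachable {α : Type*} {f : V → α} (hf : ∀ a b, G.Adj a b → f a = f b) {a b : V}
    (h : G.Reachable a b) : f a = f b := by
  obtain ⟨p⟩ := h
  induction p with
  | nil => rfl
  | cons hadj _ ih => exact (hf _ _ hadj).trans ih

lemma card_connectedComponent_deleteEdges_of_not_isBridge [Finite V] {u v : V}
    (h : ¬ G.IsBridge s(u, v)) :
    Nat.card (G.deleteEdges {s(u, v)}).ConnectedComponent = Nat.card G.ConnectedComponent := by
  rw [isBridge_iff, not_not] at h
  have hmk (a b) (hab : G.Adj a b) : (G.deleteEdges {s(u, v)}).connectedComponentMk a =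
      (G.deleteEdges {s(u, v)}).connectedComponentMk b := by
    rw [ConnectedComponent.eq]
    by_cases he : s(a, b) = s(u, v)
    · obtain ⟨rfl, rfl⟩ | ⟨rfl, rfl⟩ := Sym2.eq_iff.1 he
      exacts [h, h.symm]
    · exact (deleteEdges_adj.2 ⟨hab, he⟩).reachable
  refine le_antisymm (Nat.card_le_card_of_injective
    (ConnectedComponent.map (Hom.ofLE (deleteEdges_le (G := G) {s(u, v)}))) fun a b => ?_)
    (ConnectedComponent.card_le_card_of_le (deleteEdges_le _))
  induction a using ConnectedComponent.ind
  induction b using ConnectedComponent.ind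
  exact fun hab => eq_of_reachable hmk (ConnectedComponent.exact hab)

lemma card_connectedComponent_deleteEdges_of_isBridge [Finite V] {u v : V} (hadj : G.Adj u v)
    (h : G.IsBridge s(u, v)) :
    Nat.card (G.deleteEdges {s(u, v)}).ConnectedComponent = Nat.card G.ConnectedComponent + 1 := by
  classical
  rw [isBridge_iff] at h
  set G' := G.deleteEdges {s(u, v)} with hG'
  let mk := G'.connectedComponentMk
  let π : G'.ConnectedComponent → G.ConnectedComponent :=
    ConnectedComponent.map (Hom.ofLE (deleteEdges_le (G := G) {s(u, v)}))
  let f : V → G'.ConnectedComponent := fun a => if mk a = mk v then mk u else mk a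
  have hf (a b) (hab : G.Adj a b) : f a = f b := by
    by_cases he : s(a, b) = s(u, v)
    · obtain ⟨rfl, rfl⟩ | ⟨rfl, rfl⟩ := Sym2.eq_iff.1 he <;> simp [f]
    · have hmk : mk a = mk b := ConnectedComponent.eq.2 (deleteEdges_adj.2 ⟨hab, he⟩).reachable
      simp [f, hmk]
  apply le_antisymm
  · rw [← Finite.card_option]
    refine Nat.card_le_card_of_injective
      (fun c => if c = mk v then none else some (π c)) fun a b hab => ?_
    induction a using ConnectedComponent.ind with | h a
    induction b using ConnectedComponent.ind with | h b
    dsimp only at hab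
    split_ifs at hab with ha hb hb
    · rw [ha, hb]
    · have hfab : f a = f b :=
        eq_of_reachable hf (ConnectedComponent.exact (Option.some.inj hab))
      simpa only [f, mk, ha, hb, if_false] using hfab
  · by_contra hlt
    have hπ : Function.Bijective π :=
      (ConnectedComponent.surjective_map_ofLE _).bijective_of_nat_card_le (by lia)
    exact h (ConnectedComponent.exact (hπ.1 (ConnectedComponent.eq.2 hadj.reachable)))

lemma ncard_edgeSet_deleteEdges_singleton [Finite V] {e : Sym2 V} (he : e ∈ G.edgeSet) :
    (G.deleteEdges {e}).edgeSet.ncard + 1 = G.edgeSet.ncard := by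
  rw [edgeSet_deleteEdges, Set.ncard_sdiff_singleton_add_one he]

lemma cyclomaticNumber_deleteEdges_of_not_isBridge [Finite V] {e : Sym2 V} (he : e ∈ G.edgeSet)
    (h : ¬ G.IsBridge e) : (G.deleteEdges {e}).cyclomaticNumber + 1 = G.cyclomaticNumber := by
  have hcard := ncard_edgeSet_deleteEdges_singleton he
  induction e with | h u v
  rw [cyclomaticNumber, cyclomaticNumber, card_connectedComponent_deleteEdges_of_not_isBridge h]
  lia

lemma cyclomaticNumber_deleteEdges_of_isBridge [Finite V] {e : Sym2 V} (he : e ∈ G.edgeSet)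
    (h : G.IsBridge e) : (G.deleteEdges {e}).cyclomaticNumber = G.cyclomaticNumber := by
  have hcard := ncard_edgeSet_deleteEdges_singleton he
  induction e with | h u v
  rw [cyclomaticNumber, cyclomaticNumber, card_connectedComponent_deleteEdges_of_isBridge he h]
  lia

lemma cyclomaticNumber_mono [Finite V] (h : H ≤ G) :
    H.cyclomaticNumber ≤ G.cyclomaticNumber := by
  induction G using WellFoundedLT.induction with | ind G ih
  by_cases hsub : G.edgeSet ⊆ H.edgeSet
  · rw [le_antisymm h (edgeSet_subset_edgeSet.1 hsub)]
  · obtain ⟨e, he, heH⟩ := Set.not_subset.1 hsub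
    have hle := ih _ (deleteEdges_singleton_lt he) (le_deleteEdges_singleton h heH)
    by_cases hb : G.IsBridge e
    · rwa [cyclomaticNumber_deleteEdges_of_isBridge he hb] at hle
    · have := cyclomaticNumber_deleteEdges_of_not_isBridge he hb
      lia

lemma cyclomaticNumber_le_of_isBridge [Finite V] (h : H ≤ G)
    (hb : ∀ e ∈ G.edgeSet, e ∉ H.edgeSet → G.IsBridge e) :
    G.cyclomaticNumber ≤ H.cyclomaticNumber := by
  induction G using WellFoundedLT.induction with | ind G ih
  by_cases hsub : G.edgeSet ⊆ H.edgeSet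
  · rw [le_antisymm h (edgeSet_subset_edgeSet.1 hsub)]
  · obtain ⟨e, he, heH⟩ := Set.not_subset.1 hsub
    have hle := ih _ (deleteEdges_singleton_lt he) (le_deleteEdges_singleton h heH) fun f hf hfH =>
      (hb f (edgeSet_mono (deleteEdges_le _) hf) hfH).anti (deleteEdges_le _)
    rwa [cyclomaticNumber_deleteEdges_of_isBridge he (hb e he heH)] at hle

lemma cyclomaticNumber_bot : (⊥ : SimpleGraph V).cyclomaticNumber = 0 := by
  have hbij : Function.Bijective (⊥ : SimpleGraph V).connectedComponentMk :=
    ⟨fun a b hab => by simpa using hab, fun c => c.exists_rep⟩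
  simp [cyclomaticNumber, Nat.card_eq_of_bijective _ hbij]

lemma cyclomaticNumber_nonneg [Finite V] : 0 ≤ G.cyclomaticNumber := by
  rw [← cyclomaticNumber_bot (V := V)]
  exact cyclomaticNumber_mono bot_le

lemma cyclomaticNumber_isolate_add_one_le [Finite V] {u x : V} {p : G.Walk u u} (hp : p.IsCycle)
    (hx : x ∈ p.support) {S : Set V} (hxS : x ∈ S) :
    (isolate G S).cyclomaticNumber + 1 ≤ G.cyclomaticNumber := by
  obtain ⟨y, hy⟩ := exists_mem_edges_of_isCycle hp hx
  have hle := cyclomaticNumber_mono (isolate_le_deleteEdges (G := G) (y := y) hxS)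
  have heq := cyclomaticNumber_deleteEdges_of_not_isBridge (p.edges_subset_edgeSet hy)
    (not_isBridge_of_mem_edges hp hy)
  lia

lemma exists_mem_edges_notMem_edges {u v x : V} {p : G.Walk u u} {q : G.Walk v v}
    (hxp : x ∈ p.support) (hxq : x ∈ q.support) {e : Sym2 V} (hep : e ∈ p.edges)
    (heq : e ∉ q.edges) : ∃ a b, s(a, b) ∈ p.edges ∧ a ∈ q.support ∧ s(a, b) ∉ q.edges := by
  classical
  induction e with | h c d
  by_cases hc : c ∈ q.support
  · exact ⟨c, d, hep, hc, heq⟩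
  have hcp : c ∈ (p.rotate x hxp).support :=
    (p.mem_support_rotate_iff x hxp).2 (p.fst_mem_support_of_mem_edges hep)
  obtain ⟨δ, hδ, hfst, hsnd⟩ :=
    ((p.rotate x hxp).takeUntil c hcp).exists_boundary_dart {y | y ∈ q.support} hxq hc
  refine ⟨δ.fst, δ.snd, (p.rotate_edges x hxp).mem_iff.1 ?_, hfst,
    fun h => hsnd (q.snd_mem_support_of_mem_edges h)⟩
  exact Walk.edges_takeUntil_subset_edges _ hcp (List.mem_map_of_mem hδ)

lemma exists_cyclomaticNumber_isolate_add_two_le [Finite V] (h : ¬ G.DisjointCycles) :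
    ∃ x, (isolate G {x}).cyclomaticNumber + 2 ≤ G.cyclomaticNumber := by
  rw [disjointCycles_iff] at h
  push Not at h
  obtain ⟨u, v, p, q, hp, hq, x, hxp, hxq, e, hep, heq⟩ := h
  obtain ⟨a, b, hab, haq, habq⟩ := exists_mem_edges_notMem_edges hxp hxq hep heq
  have hdelete := cyclomaticNumber_deleteEdges_of_not_isBridge (p.edges_subset_edgeSet hab)
    (not_isBridge_of_mem_edges hp hab)
  have hqG : ∀ f ∈ q.edges, f ∈ (G.deleteEdges {s(a, b)}).edgeSet := fun f hf => by
    rw [edgeSet_deleteEdges]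
    exact ⟨q.edges_subset_edgeSet hf, by rintro rfl; exact habq hf⟩
  have hisolate := cyclomaticNumber_isolate_add_one_le (hq.transfer hqG) (x := a)
    (by rwa [Walk.support_transfer]) (Set.mem_singleton a)
  have hmono : isolate G {a} ≤ isolate (G.deleteEdges {s(a, b)}) {a} := fun c d hcd =>
    ⟨isolate_le_deleteEdges (Set.mem_singleton a) hcd, hcd.2⟩
  have := cyclomaticNumber_mono hmono
  exact ⟨a, by lia⟩

end Cyclomatic

section Matchings

variable {V W : Type*} {G H : SimpleGraph V}

/-- A matching of `G`, encoded as a finite set of pairwise disjoint edges. -/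
def IsMatchingSet (G : SimpleGraph V) (M : Finset (Sym2 V)) : Prop :=
  (∀ e ∈ M, e ∈ G.edgeSet) ∧ ∀ e ∈ M, ∀ f ∈ M, ∀ v, v ∈ e → v ∈ f → e = f

lemma IsMatchingSet.subset {M N : Finset (Sym2 V)} (hM : IsMatchingSet G M) (h : N ⊆ M) :
    IsMatchingSet G N :=
  ⟨fun e he => hM.1 e (h he), fun e he f hf => hM.2 e (h he) f (h hf)⟩

lemma IsMatchingSet.exists_subgraph {M : Finset (Sym2 V)} (hM : IsMatchingSet G M) :
    ∃ N : G.Subgraph, N.IsMatching ∧ N.edgeSet = M := by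
  let N : G.Subgraph :=
    { verts := {v | ∃ e ∈ M, v ∈ e}
      Adj a b := s(a, b) ∈ M
      adj_sub h := hM.1 _ h
      edge_vert {a b} h := ⟨s(a, b), h, Sym2.mem_mk_left a b⟩
      symm.symm a b h := by rwa [Sym2.eq_swap] }
  refine ⟨N, ?_, ?_⟩
  · rintro v ⟨e, he, hv⟩
    obtain ⟨w, rfl⟩ := Sym2.mem_iff_exists.1 hv
    exact ⟨w, he, fun y hy => Sym2.congr_right.1
      (hM.2 _ hy _ he v (Sym2.mem_mk_left _ _) (Sym2.mem_mk_left _ _))⟩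
  · ext ⟨a, b⟩
    rfl

lemma isMatchingSet_of_coe_eq_edgeSet {M : Finset (Sym2 V)} {N : G.Subgraph} (hN : N.IsMatching)
    (hM : (M : Set (Sym2 V)) = N.edgeSet) : IsMatchingSet G M := by
  have hmem (e : Sym2 V) : e ∈ M ↔ e ∈ N.edgeSet := by rw [← hM, Finset.mem_coe]
  refine ⟨fun e he => N.edgeSet_subset ((hmem e).1 he), fun e he f hf v hve hvf => ?_⟩
  obtain ⟨a, rfl⟩ := Sym2.mem_iff_exists.1 hve
  obtain ⟨b, rfl⟩ := Sym2.mem_iff_exists.1 hvf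
  exact Sym2.congr_right.2 (hN.eq_of_adj_left ((hmem _).1 he) ((hmem _).1 hf))

lemma IsMatchingSet.card_le_ncard {M : Finset (Sym2 V)} (hM : IsMatchingSet G M) {K : Set V}
    (hK : K.Finite) (h : ∀ e ∈ M, ∃ v ∈ e, v ∈ K) : M.card ≤ K.ncard := by
  rw [Set.ncard_eq_toFinset_card _ hK]
  refine Finset.card_le_card_of_forall_subsingleton (fun e v => v ∈ e) (fun e he => ?_)
    fun v _ e he f hf => hM.2 e he.1 f hf.1 v he.2 hf.2
  obtain ⟨v, hve, hvK⟩ := h e he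
  exact ⟨v, hK.mem_toFinset.2 hvK, hve⟩

lemma IsMatchingSet.two_mul_card_le_ncard {M : Finset (Sym2 V)} (hM : IsMatchingSet G M)
    {K : Set V} (hK : K.Finite) (h : ∀ e ∈ M, ∀ v ∈ e, v ∈ K) : 2 * M.card ≤ K.ncard := by
  classical
  have hcard : (M.biUnion Sym2.toFinset).card = 2 * M.card := by
    rw [Finset.card_biUnion, Finset.sum_congr rfl fun e he =>
      Sym2.card_toFinset_of_not_isDiag e (G.not_isDiag_of_mem_edgeSet (hM.1 e he)),
      Finset.sum_const, smul_eq_mul, mul_comm]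
    refine fun e he f hf hef => Finset.disjoint_left.2 fun v hve hvf => ?_
    exact hef (hM.2 e he f hf v (Sym2.mem_toFinset.1 hve) (Sym2.mem_toFinset.1 hvf))
  rw [← hcard, ← Set.ncard_coe_finset]
  refine Set.ncard_le_ncard (fun v hv => ?_) hK
  obtain ⟨e, he, hve⟩ := Finset.mem_biUnion.1 hv
  exact h e he v (Sym2.mem_toFinset.1 hve)

lemma IsMatchingSet.union [DecidableEq V] {M N : Finset (Sym2 V)} {S : Set V}
    (hM : IsMatchingSet G M) (hN : IsMatchingSet (isolate G S) N)
    (hMS : ∀ e ∈ M, ∀ v ∈ e, v ∈ S) : IsMatchingSet G (N ∪ M) ∧ Disjoint N M := by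
  have hNS (e) (he : e ∈ N) (v) (hv : v ∈ e) : v ∉ S := by
    obtain ⟨w, rfl⟩ := Sym2.mem_iff_exists.1 hv
    exact (hN.1 _ he).2.1
  refine ⟨⟨fun e he => ?_, fun e he f hf v hve hvf => ?_⟩, Finset.disjoint_left.2 ?_⟩
  · exact (Finset.mem_union.1 he).elim (fun he => edgeSet_mono (isolate_le S) (hN.1 e he)) (hM.1 e)
  · rcases Finset.mem_union.1 he with he | he <;> rcases Finset.mem_union.1 hf with hf | hf
    · exact hN.2 e he f hf v hve hvf
    · exact absurd (hMS f hf v hvf) (hNS e he v hve)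
    · exact absurd (hMS e he v hve) (hNS f hf v hvf)
    · exact hM.2 e he f hf v hve hvf
  · rintro ⟨a, b⟩ he he'
    exact hNS _ he a (Sym2.mem_mk_left a b) (hMS _ he' a (Sym2.mem_mk_left a b))

lemma bddAbove_ncard_isMatching [Finite V] (G : SimpleGraph V) :
    BddAbove {k | ∃ M : G.Subgraph, M.IsMatching ∧ M.edgeSet.ncard = k} := by
  refine ⟨Nat.card (Sym2 V), ?_⟩
  rintro k ⟨M, -, rfl⟩
  exact Set.ncard_le_card _

lemma IsMatchingSet.card_le_matchingNumber [Finite V] {M : Finset (Sym2 V)}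
    (hM : IsMatchingSet G M) : M.card ≤ G.matchingNumber := by
  obtain ⟨N, hN, hNM⟩ := hM.exists_subgraph
  exact le_csSup (bddAbove_ncard_isMatching G) ⟨N, hN, by rw [hNM, Set.ncard_coe_finset]⟩

lemma exists_isMatchingSet_card_eq [Finite V] (G : SimpleGraph V) :
    ∃ M : Finset (Sym2 V), IsMatchingSet G M ∧ M.card = G.matchingNumber := by
  have hne : {k | ∃ M : G.Subgraph, M.IsMatching ∧ M.edgeSet.ncard = k}.Nonempty :=
    ⟨_, ⊥, fun v hv => (hv : False).elim, rfl⟩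
  obtain ⟨N, hN, hcard⟩ := Nat.sSup_mem hne (bddAbove_ncard_isMatching G)
  have hfin : N.edgeSet.Finite := Set.toFinite _
  exact ⟨hfin.toFinset, isMatchingSet_of_coe_eq_edgeSet hN hfin.coe_toFinset, by
    rw [← Set.ncard_eq_toFinset_card _ hfin, hcard, matchingNumber]⟩

lemma matchingNumber_le_of_injOn_support [Finite V] [Finite W] {G' : SimpleGraph W} (f : V → W)
    (hadj : ∀ a b, G.Adj a b → G'.Adj (f a) (f b)) (hinj : Set.InjOn f G.support) :
    G.matchingNumber ≤ G'.matchingNumber := by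
  classical
  obtain ⟨M, hM, hcard⟩ := exists_isMatchingSet_card_eq G
  have hinj_edge (e) (he : e ∈ M) (e') (he' : e' ∈ M) (a) (ha : a ∈ e) (b) (hb : b ∈ e')
      (hab : f a = f b) : e = e' := by
    obtain ⟨c, rfl⟩ := Sym2.mem_iff_exists.1 ha
    obtain ⟨d, rfl⟩ := Sym2.mem_iff_exists.1 hb
    obtain rfl : a = b := hinj ⟨c, hM.1 _ he⟩ ⟨d, hM.1 _ he'⟩ hab
    exact hM.2 _ he _ he' a ha hb
  have hmap : IsMatchingSet G' (M.image (Sym2.map f)) := by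
    constructor
    · intro _ he
      obtain ⟨⟨a, b⟩, hab, rfl⟩ := Finset.mem_image.1 he
      exact hadj a b (hM.1 _ hab)
    · intro _ he _ he' v hv hv'
      obtain ⟨e, heM, rfl⟩ := Finset.mem_image.1 he
      obtain ⟨e', heM', rfl⟩ := Finset.mem_image.1 he'
      obtain ⟨a, ha, rfl⟩ := Sym2.mem_map.1 hv
      obtain ⟨b, hb, hab⟩ := Sym2.mem_map.1 hv'
      rw [hinj_edge e heM e' heM' a ha b hb hab.symm]
  rw [← hcard, ← Finset.card_image_of_injOn (f := Sym2.map f)]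
  · exact hmap.card_le_matchingNumber
  · rintro ⟨a, c⟩ he e' he' hee'
    have ha : f a ∈ Sym2.map f e' := hee' ▸ Sym2.mem_map.2 ⟨a, Sym2.mem_mk_left a c, rfl⟩
    obtain ⟨b, hb, hab⟩ := Sym2.mem_map.1 ha
    exact hinj_edge _ he _ he' a (Sym2.mem_mk_left a c) b hb hab.symm

lemma matchingNumber_mono [Finite V] (h : H ≤ G) : H.matchingNumber ≤ G.matchingNumber :=
  matchingNumber_le_of_injOn_support id (fun _ _ hab => h hab) Function.injective_id.injOn

lemma matchingNumber_induce_compl [Finite V] (S : Set V) :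
    (G.induce (Sᶜ : Set V)).matchingNumber = (isolate G S).matchingNumber := by
  classical
  apply le_antisymm
  · exact matchingNumber_le_of_injOn_support Subtype.val (fun a b hab => ⟨hab, a.2, b.2⟩)
      Subtype.val_injective.injOn
  · by_cases hS : (Sᶜ : Set V).Nonempty
    · obtain ⟨x₀, hx₀⟩ := hS
      have hnot {a b : V} (hab : (isolate G S).Adj a b) : a ∈ Sᶜ := hab.2.1
      refine matchingNumber_le_of_injOn_support
        (fun x => if hx : x ∈ Sᶜ then (⟨x, hx⟩ : (Sᶜ : Set V)) else ⟨x₀, hx₀⟩)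
        (fun a b hab => ?_) ?_
      · simpa only [dif_pos (hnot hab), dif_pos (hnot hab.symm), induce_adj] using hab.1
      · rintro a ⟨c, hac⟩ b ⟨d, hbd⟩ hab
        simpa only [dif_pos (hnot hac), dif_pos (hnot hbd), Subtype.mk.injEq] using hab
    · obtain ⟨M, hM, hcard⟩ := exists_isMatchingSet_card_eq (isolate G S)
      obtain rfl : M = ∅ := Finset.eq_empty_of_forall_notMem fun e he => by
        induction e with | h a b
        exact hS ⟨a, (hM.1 _ he).2.1⟩
      simp [← hcard]

lemma matchingNumber_le_isolate_add [Finite V] (S : Set V) (l : ℕ)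
    (h : ∀ M : Finset (Sym2 V), IsMatchingSet G M → (∀ e ∈ M, ∃ v ∈ e, v ∈ S) → M.card ≤ l) :
    G.matchingNumber ≤ (isolate G S).matchingNumber + l := by
  classical
  obtain ⟨M, hM, hcard⟩ := exists_isMatchingSet_card_eq G
  have hmeet := h (M.filter fun e => ∃ v ∈ e, v ∈ S) (hM.subset (Finset.filter_subset _ _))
    fun e he => (Finset.mem_filter.1 he).2
  have hmiss : IsMatchingSet (isolate G S) (M.filter fun e => ¬ ∃ v ∈ e, v ∈ S) := by
    refine ⟨?_, (hM.subset (Finset.filter_subset _ _)).2⟩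
    rintro ⟨a, b⟩ he
    obtain ⟨he, hS⟩ := Finset.mem_filter.1 he
    exact ⟨hM.1 _ he, fun ha => hS ⟨a, Sym2.mem_mk_left a b, ha⟩,
      fun hb => hS ⟨b, Sym2.mem_mk_right a b, hb⟩⟩
  rw [← hcard, ← Finset.card_filter_add_card_filter_not (s := M) fun e => ∃ v ∈ e, v ∈ S, add_comm]
  exact add_le_add hmiss.card_le_matchingNumber hmeet

lemma matchingNumber_le_isolate_add_ncard [Finite V] (K : Set V) :
    G.matchingNumber ≤ (isolate G K).matchingNumber + K.ncard :=
  matchingNumber_le_isolate_add K _ fun _ hM h => hM.card_le_ncard K.toFinite h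

lemma matchingNumber_le_isolate_add_half_ncard [Finite V] {K : Set V}
    (h : ∀ a b, G.Adj a b → a ∈ K → b ∈ K) :
    G.matchingNumber ≤ (isolate G K).matchingNumber + K.ncard / 2 := by
  refine matchingNumber_le_isolate_add K _ fun M hM hMK => ?_
  have hle := hM.two_mul_card_le_ncard K.toFinite fun e he v hv => by
    obtain ⟨w, rfl⟩ := Sym2.mem_iff_exists.1 hv
    obtain ⟨x, hx, hxK⟩ := hMK _ he
    rcases Sym2.mem_iff.1 hx with rfl | rfl
    · exact hxK
    · exact h _ _ (hM.1 _ he).symm hxK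
  lia

lemma IsMatchingSet.matchingNumber_isolate_add_card_le [Finite V] {M : Finset (Sym2 V)}
    (hM : IsMatchingSet G M) {S : Set V} (h : ∀ e ∈ M, ∀ v ∈ e, v ∈ S) :
    (isolate G S).matchingNumber + M.card ≤ G.matchingNumber := by
  classical
  obtain ⟨N, hN, hcard⟩ := exists_isMatchingSet_card_eq (isolate G S)
  obtain ⟨hunion, hdisj⟩ := hM.union hN h
  rw [← hcard, ← Finset.card_union_of_disjoint hdisj]
  exact hunion.card_le_matchingNumber

lemma matchingNumber_isolate_add_one_le [Finite V] {x y : V} (h : G.Adj x y) {S : Set V}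
    (hx : x ∈ S) (hy : y ∈ S) : (isolate G S).matchingNumber + 1 ≤ G.matchingNumber := by
  have hM : IsMatchingSet G {s(x, y)} := by simpa [IsMatchingSet] using h
  refine hM.matchingNumber_isolate_add_card_le fun e he v hv => ?_
  rw [Finset.mem_singleton.1 he, Sym2.mem_iff] at hv
  rcases hv with rfl | rfl <;> assumption

lemma matchingNumber_isolate_add_le_of_isPath [Finite V] {S : Set V} {u v : V} (p : G.Walk u v)
    (hp : p.IsPath) (hS : ∀ x ∈ p.support, x ∈ S) :
    (isolate G S).matchingNumber + (p.length + 1) / 2 ≤ G.matchingNumber := by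
  induction hn : p.length using Nat.strong_induction_on generalizing G u with | h n ih
  match p, hp with
  | .nil, _ =>
    simpa [← hn] using matchingNumber_mono (isolate_le S)
  | .cons h .nil, _ =>
    simpa [← hn] using
      matchingNumber_isolate_add_one_le h (hS _ (by simp)) (hS _ (by simp))
  | .cons (v := a) h (.cons h' q), hp =>
    obtain ⟨⟨hq, haq⟩, huq⟩ := by simpa only [Walk.cons_isPath_iff] using hp
    have hqG : ∀ e ∈ q.edges, e ∈ (isolate G {u, a}).edgeSet :=
      edges_subset_edgeSet_isolate q fun x hx => by
        rintro (rfl | rfl)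
        · exact huq (by simp [hx])
        · exact haq hx
    have hrest := ih q.length (by simp [← hn]) (q.transfer _ hqG) (hq.transfer _)
      (fun x hx => hS x (by simp_all)) (by simp)
    have hedge := matchingNumber_isolate_add_one_le h (S := {u, a}) (by simp) (by simp)
    rw [isolate_isolate, Set.union_eq_self_of_subset_left] at hrest
    · simp only [Walk.length_cons] at hn
      lia
    · rintro x (rfl | rfl)
      exacts [hS _ (by simp), hS _ (by simp)]

end Matchings

section Leaves

variable {V : Type*} {G : SimpleGraph V}

/-- The vertex `x` is a leaf (pendant vertex) of `G`, and `y` is its only neighbour. -/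
def IsLeaf (G : SimpleGraph V) (x y : V) : Prop :=
  G.Adj x y ∧ ∀ z, G.Adj x z → z = y

lemma IsLeaf.isolate_pair {x y : V} (h : IsLeaf G x y) : isolate G {x, y} = isolate G {y} := by
  refine (isolate_mono le_rfl (Set.subset_insert _ _)).antisymm ?_
  rintro a b ⟨hab, ha, hb⟩
  refine ⟨hab, ?_, ?_⟩
  · rintro (rfl | hay)
    exacts [hb (h.2 _ hab), ha hay]
  · rintro (rfl | hby)
    exacts [ha (h.2 _ hab.symm), hb hby]

lemma IsLeaf.matchingNumber_isolate_add_one_le [Finite V] {x y : V} (h : IsLeaf G x y) :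
    (isolate G {y}).matchingNumber + 1 ≤ G.matchingNumber := by
  rw [← h.isolate_pair]
  exact UnitGainGraph.matchingNumber_isolate_add_one_le h.1 (by simp) (by simp)

lemma exists_isLeaf_of_isAcyclic [Finite V] (hG : G.IsAcyclic) (hne : G ≠ ⊥) :
    ∃ x y, IsLeaf G x y := by
  classical
  obtain ⟨a, b, hab⟩ := ne_bot_iff_exists_adj.1 hne
  have : Nonempty V := ⟨a⟩
  obtain ⟨x, v, p, hp, hmax⟩ := Walk.exists_isPath_forall_isPath_length_le_length G
  have hnil : ¬ p.Nil := fun h => by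
    have hle := hmax _ _ hab.toWalk hab.isPath_toWalk
    rw [Walk.length_eq_zero_iff.2 h] at hle
    simp at hle
  refine ⟨x, p.snd, p.adj_snd hnil, fun z hz => hG.eq_snd_of_adj_start hp hz ?_⟩
  by_contra hzp
  have hle := hmax _ _ (Walk.cons hz.symm p) (hp.cons hzp)
  simp at hle

lemma exists_isVertexCover_of_isAcyclic [Finite V] (hG : G.IsAcyclic) :
    ∃ K : Set V, G.IsVertexCover K ∧ K.ncard ≤ G.matchingNumber := by
  induction G using WellFoundedLT.induction with | ind G ih
  by_cases hne : G = ⊥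
  · exact ⟨∅, isVertexCover_empty.2 hne, by simp⟩
  obtain ⟨x, y, hxy⟩ := exists_isLeaf_of_isAcyclic hG hne
  obtain ⟨K, hK, hcard⟩ := ih (isolate G {y}) (isolate_lt hxy.1.symm rfl)
    (hG.anti (isolate_le _))
  refine ⟨insert y K, fun a b hab => ?_, ?_⟩
  · by_cases ha : a = y
    · exact Or.inl (Or.inl ha)
    by_cases hb : b = y
    · exact Or.inr (Or.inl hb)
    exact (hK ⟨hab, ha, hb⟩).imp Or.inr Or.inr
  · have := hxy.matchingNumber_isolate_add_one_le
    have := Set.ncard_insert_le y K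
    lia

end Leaves

section Weights

variable {V : Type*} {G H : SimpleGraph V} {B : Matrix V V ℂ}

/-- Entrywise, `B` assigns to the edges of `H` the gains of a complex unit gain graph. Nothing is
required of the entries of `B` outside the edges of `H`, so that `B` serves all subgraphs of `H`. -/
def IsUnitWeight (H : SimpleGraph V) (B : Matrix V V ℂ) : Prop :=
  B.IsHermitian ∧ ∀ u v, H.Adj u v → ‖B u v‖ = 1

lemma IsUnitWeight.anti (hB : IsUnitWeight G B) (h : H ≤ G) : IsUnitWeight H B :=
  ⟨hB.1, fun u v huv => hB.2 u v (h huv)⟩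

lemma IsUnitWeight.mul_eq_one (hB : IsUnitWeight G B) {u v : V} (h : G.Adj u v) :
    B u v * B v u = 1 := by
  rw [← hB.1.apply v u, Complex.star_def, Complex.mul_conj, Complex.normSq_eq_norm_sq, hB.2 u v h]
  simp

open Classical in
/-- The adjacency matrix of the gain graph on `H` whose gains are the entries of `B`. -/
noncomputable def weightMatrix (H : SimpleGraph V) (B : Matrix V V ℂ) : Matrix V V ℂ :=
  Matrix.of fun u v => if H.Adj u v then B u v else 0

lemma weightMatrix_of_adj {u v : V} (h : H.Adj u v) : weightMatrix H B u v = B u v := if_pos h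

lemma weightMatrix_of_not_adj {u v : V} (h : ¬ H.Adj u v) : weightMatrix H B u v = 0 := if_neg h

lemma isHermitian_weightMatrix (hB : B.IsHermitian) : (weightMatrix H B).IsHermitian := by
  ext u v
  rw [conjTranspose_apply]
  by_cases h : H.Adj u v
  · rw [weightMatrix_of_adj h, weightMatrix_of_adj h.symm, hB.apply]
  · rw [weightMatrix_of_not_adj h, weightMatrix_of_not_adj (fun h' => h h'.symm), star_zero]

lemma weightMatrix_isolate [Fintype V] (S : Set V) :
    weightMatrix (isolate H S) B = zeroOn (weightMatrix H B) S := by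
  ext u v
  rw [zeroOn_apply]
  split_ifs with hS
  · exact weightMatrix_of_not_adj fun h => hS.elim h.2.1 h.2.2
  · by_cases h : H.Adj u v
    · rw [weightMatrix_of_adj h, weightMatrix_of_adj (H := isolate H S) ⟨h, not_or.1 hS⟩]
    · rw [weightMatrix_of_not_adj h, weightMatrix_of_not_adj (H := isolate H S) fun h' => h h'.1]

/-- The negative inertia index of the gain graph on `H` whose gains are the entries of `B`. -/
noncomputable def weightNegIndex [Fintype V] (H : SimpleGraph V) (B : Matrix V V ℂ) : ℕ :=
  negIndex (weightMatrix H B)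

variable [Fintype V]

lemma weightNegIndex_isolate_le (S : Set V) :
    weightNegIndex (isolate H S) B ≤ weightNegIndex H B := by
  rw [weightNegIndex, weightMatrix_isolate]
  exact negIndex_zeroOn_le _ S

lemma weightNegIndex_le_isolate_add_ncard (S : Set V) :
    weightNegIndex H B ≤ weightNegIndex (isolate H S) B + S.ncard := by
  rw [weightNegIndex, weightNegIndex, weightMatrix_isolate]
  exact negIndex_le_negIndex_zeroOn_add_ncard _ S

lemma weightNegIndex_le_isolate_singleton_add_one (v : V) :
    weightNegIndex H B ≤ weightNegIndex (isolate H {v}) B + 1 := by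
  simpa only [Set.ncard_singleton] using weightNegIndex_le_isolate_add_ncard (H := H) (B := B) {v}

lemma IsLeaf.weightNegIndex_isolate_add_one_le {x y : V} (h : IsLeaf H x y)
    (hB : IsUnitWeight H B) : weightNegIndex (isolate H {y}) B + 1 ≤ weightNegIndex H B := by
  rw [weightNegIndex, weightNegIndex, weightMatrix_isolate]
  refine negIndex_zeroOn_singleton_add_one_le_of_pendant (isHermitian_weightMatrix hB.1) h.1.ne
    (fun w hw => weightMatrix_of_not_adj fun hadj => hw (h.2 w hadj))
    (weightMatrix_of_not_adj (H.loopless.irrefl y)) ?_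
  rw [weightMatrix_of_adj h.1]
  exact left_ne_zero_of_mul_eq_one (hB.mul_eq_one h.1)

lemma weightNegIndex_bot : weightNegIndex (⊥ : SimpleGraph V) B = 0 := by
  classical
  have hdiag : weightMatrix (⊥ : SimpleGraph V) B = diagonal fun _ => ((0 : ℝ) : ℂ) := by
    ext u v
    rw [weightMatrix_of_not_adj (by simp)]
    simp
  rw [weightNegIndex, hdiag]
  simpa using negIndex_diagonal (V := V) (𝕜 := ℂ) fun _ => 0

lemma weightNegIndex_le_ncard_of_isVertexCover {K : Set V} (hK : H.IsVertexCover K) :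
    weightNegIndex H B ≤ K.ncard := by
  have hbot : isolate H K = ⊥ := by
    ext a b
    simp only [isolate_adj, bot_adj, iff_false]
    rintro ⟨hab, ha, hb⟩
    exact (hK hab).elim ha hb
  have := weightNegIndex_le_isolate_add_ncard (H := H) (B := B) K
  rwa [hbot, weightNegIndex_bot, zero_add] at this

theorem weightNegIndex_le_matchingNumber_add_cyclomaticNumber (G : SimpleGraph V) :
    (weightNegIndex G B : ℤ) ≤ G.matchingNumber + G.cyclomaticNumber := by
  induction G using WellFoundedLT.induction with | ind G ih
  by_cases hG : G.IsAcyclic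
  · obtain ⟨K, hK, hcard⟩ := exists_isVertexCover_of_isAcyclic hG
    have := weightNegIndex_le_ncard_of_isVertexCover (B := B) hK
    have := cyclomaticNumber_nonneg (G := G)
    lia
  · obtain ⟨u, p, hp⟩ : ∃ (u : V) (p : G.Walk u u), p.IsCycle := by
      simpa only [IsAcyclic, not_forall, not_not] using hG
    have := ih (isolate G {u}) (isolate_lt (p.adj_snd hp.not_nil) rfl)
    have := weightNegIndex_le_isolate_singleton_add_one (H := G) (B := B) u
    have := cyclomaticNumber_isolate_add_one_le hp p.start_mem_support (Set.mem_singleton u)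
    have := matchingNumber_mono (isolate_le (G := G) {u})
    lia

/-- The gain graph on `H` with gains `B` is extremal: its negative inertia index equals the upper
bound given by the matching number and the cyclomatic number. -/
def AttainsBound (H : SimpleGraph V) (B : Matrix V V ℂ) : Prop :=
  (weightNegIndex H B : ℤ) = H.matchingNumber + H.cyclomaticNumber

lemma AttainsBound.disjointCycles (h : AttainsBound G B) : G.DisjointCycles := by
  unfold AttainsBound at h
  by_contra hG
  obtain ⟨x, hx⟩ := exists_cyclomaticNumber_isolate_add_two_le hG
  have := weightNegIndex_le_matchingNumber_add_cyclomaticNumber (B := B) (isolate G {x})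
  have := weightNegIndex_le_isolate_singleton_add_one (H := G) (B := B) x
  have := matchingNumber_mono (isolate_le (G := G) {x})
  lia

end Weights

section MatchedSets

variable {V : Type*} {H : SimpleGraph V} {K : Set V} {π : V → V}

/-- The vertices of `K` are matched by `π` to vertices outside `K` all of whose neighbours lie
in `K`. -/
structure IsMatchedSet (H : SimpleGraph V) (K : Set V) (π : V → V) : Prop where
  injOn : Set.InjOn π K
  notMem : ∀ y ∈ K, π y ∉ K
  adj : ∀ y ∈ K, H.Adj (π y) y
  mem_of_adj : ∀ y ∈ K, ∀ z, H.Adj (π y) z → z ∈ K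

/-- The subgraph of `H` spanned by `K` and its partners under `π`. -/
def matchedPart (H : SimpleGraph V) (K : Set V) (π : V → V) : SimpleGraph V :=
  isolate H (K ∪ π '' K)ᶜ

lemma matchedPart_mono {H' : SimpleGraph V} (h : H' ≤ H) {L : Set V} (hL : L ⊆ K) :
    matchedPart H' L π ≤ matchedPart H K π :=
  isolate_mono h (Set.compl_subset_compl.2 (Set.union_subset_union hL (Set.image_mono hL)))

lemma IsMatchedSet.matchedPart_adj (h : IsMatchedSet H K π) {y z : V} (hy : y ∈ K)
    (hadj : H.Adj (π y) z) : (matchedPart H K π).Adj (π y) z :=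
  ⟨hadj, not_not.2 (Or.inr ⟨y, hy, rfl⟩), not_not.2 (Or.inl (h.mem_of_adj y hy z hadj))⟩

lemma IsMatchedSet.isolate_diff_singleton (h : IsMatchedSet H K π) {y : V} (hy : y ∈ K) :
    IsMatchedSet (isolate H {y}) (K \ {y}) π where
  injOn := h.injOn.mono Set.sdiff_subset
  notMem z hz hπz := h.notMem z hz.1 hπz.1
  adj z hz := ⟨h.adj z hz.1, fun hzy => h.notMem z hz.1 (hzy ▸ hy), hz.2⟩
  mem_of_adj z hz t ht := ⟨h.mem_of_adj z hz.1 t ht.1, ht.2.2⟩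

lemma IsMatchedSet.diff_singleton (h : IsMatchedSet H K π) {a b : V} (ha : a ∈ K)
    (hleaf : IsLeaf (matchedPart H K π) a b) : IsMatchedSet H (K \ {a}) π where
  injOn := h.injOn.mono Set.sdiff_subset
  notMem z hz hπz := h.notMem z hz.1 hπz.1
  adj z hz := h.adj z hz.1
  mem_of_adj z hz t ht := by
    refine ⟨h.mem_of_adj z hz.1 t ht, ?_⟩
    rintro rfl
    have hz' := hleaf.2 _ (h.matchedPart_adj hz.1 ht).symm
    have ha' := hleaf.2 _ (h.matchedPart_adj ha (h.adj _ ha)).symm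
    exact hz.2 (h.injOn hz.1 ha (hz'.trans ha'.symm))

variable [Fintype V] {B : Matrix V V ℂ}

/-- A leaf of the matched part lies in `K` or is the partner of a vertex of `K`; the corresponding
pair is eliminated last in the first case and first in the second. -/
theorem IsMatchedSet.ncard_add_weightNegIndex_isolate_le (h : IsMatchedSet H K π)
    (hac : (matchedPart H K π).IsAcyclic) (hB : IsUnitWeight H B) :
    K.ncard + weightNegIndex (isolate H K) B ≤ weightNegIndex H B := by
  induction hn : K.ncard generalizing H K with
  | zero => simpa using weightNegIndex_isolate_le K
  | succ n ih =>
    obtain ⟨y₀, hy₀⟩ := Set.nonempty_of_ncard_ne_zero (s := K) (by lia)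
    obtain ⟨a, b, hab⟩ := exists_isLeaf_of_isAcyclic hac
      (ne_bot_iff_exists_adj.2 ⟨_, _, h.matchedPart_adj hy₀ (h.adj y₀ hy₀)⟩)
    rcases not_not.1 hab.1.2.1 with ha | ⟨y, hy, rfl⟩
    · have hK := ih (h.diff_singleton ha hab)
        (hac.anti (matchedPart_mono le_rfl Set.sdiff_subset)) hB
        (by rw [Set.ncard_sdiff_singleton_of_mem ha, hn, Nat.add_sub_cancel])
      have hleaf : IsLeaf (isolate H (K \ {a})) (π a) a :=
        ⟨⟨h.adj a ha, fun hπ => h.notMem a ha hπ.1, fun haK => haK.2 rfl⟩, fun z hz =>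
          by_contra fun hza => hz.2.2 ⟨h.mem_of_adj a ha z hz.1, hza⟩⟩
      have := hleaf.weightNegIndex_isolate_add_one_le (hB.anti (isolate_le _))
      rw [isolate_isolate, Set.sdiff_union_of_subset (Set.singleton_subset_iff.2 ha)] at this
      lia
    · have hK := ih (h.isolate_diff_singleton hy)
        (hac.anti (matchedPart_mono (isolate_le _) Set.sdiff_subset)) (hB.anti (isolate_le _))
        (by rw [Set.ncard_sdiff_singleton_of_mem hy, hn, Nat.add_sub_cancel])
      obtain rfl := hab.2 y (h.matchedPart_adj hy (h.adj y hy))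
      have hleaf : IsLeaf H (π y) y :=
        ⟨h.adj y hy, fun z hz => hab.2 z (h.matchedPart_adj hy hz)⟩
      have := hleaf.weightNegIndex_isolate_add_one_le hB
      rw [isolate_isolate, Set.union_sdiff_cancel (Set.singleton_subset_iff.2 hy)] at hK
      lia

end MatchedSets

section PendantCycles

variable {V : Type*} {H : SimpleGraph V}

/-- `q` traverses a connected component of `H` which is a path. -/
structure IsPathComponent {a b : V} (q : H.Walk a b) : Prop where
  isPath : q.IsPath
  mem_edges : ∀ x ∈ q.support, ∀ z, H.Adj x z → s(x, z) ∈ q.edges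

/-- `p` traverses a cycle which is joined to the rest of `H` at its base point only. -/
structure IsPendantCycle {u : V} (p : H.Walk u u) : Prop where
  isCycle : p.IsCycle
  mem_edges : ∀ x ∈ p.support, x ≠ u → ∀ z, H.Adj x z → s(x, z) ∈ p.edges

/-- `p` traverses a connected component of `H` which is a cycle. -/
structure IsIsolatedCycle {u : V} (p : H.Walk u u) : Prop where
  isCycle : p.IsCycle
  mem_edges : ∀ x ∈ p.support, ∀ z, H.Adj x z → s(x, z) ∈ p.edges

lemma IsIsolatedCycle.isPendantCycle {u : V} {p : H.Walk u u} (h : IsIsolatedCycle p) :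
    IsPendantCycle p :=
  ⟨h.isCycle, fun x hx _ => h.mem_edges x hx⟩

lemma IsPathComponent.isLeaf {a b c : V} {h : H.Adj a b} {q : H.Walk b c}
    (hq : IsPathComponent (.cons h q)) : IsLeaf H a b := by
  obtain ⟨-, haq⟩ := (Walk.cons_isPath_iff _ _).1 hq.isPath
  refine ⟨h, fun z hz => ?_⟩
  have hmem := hq.mem_edges a (Walk.start_mem_support _) z hz
  rw [Walk.edges_cons, List.mem_cons] at hmem
  rcases hmem with heq | hmem
  · exact Sym2.congr_right.1 heq
  · exact absurd (q.fst_mem_support_of_mem_edges hmem) haq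

lemma IsPathComponent.exists_isolate {a b c d : V} {h : H.Adj a b} {h' : H.Adj b c} {q : H.Walk c d}
    (hq : IsPathComponent (.cons h (.cons h' q))) :
    ∃ q' : (isolate H {b}).Walk c d, IsPathComponent q' ∧ q'.length = q.length ∧
      q'.support = q.support := by
  obtain ⟨⟨hqpath, hbq⟩, haq⟩ := by simpa only [Walk.cons_isPath_iff] using hq.isPath
  have hqb : ∀ e ∈ q.edges, e ∈ (isolate H {b}).edgeSet :=
    edges_subset_edgeSet_isolate q fun x hx hxb => hbq (hxb ▸ hx)
  refine ⟨q.transfer _ hqb, ⟨hqpath.transfer _, fun x hx z hz => ?_⟩, by simp, by simp⟩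
  rw [Walk.support_transfer] at hx
  have hxa : x ≠ a := by
    rintro rfl
    exact haq (by simp [hx])
  have hmem := hq.mem_edges x (by simp [hx]) z hz.1
  have hxb : x ≠ b := hz.2.1
  have hzb : z ≠ b := hz.2.2
  simpa [hxa, hxb, hzb] using hmem

lemma IsPendantCycle.exists_isPathComponent {u : V} {p : H.Walk u u} (hp : IsPendantCycle p) :
    ∃ (a b : V) (q : (isolate H {u}).Walk a b), IsPathComponent q ∧ q.length + 2 = p.length ∧
      {u} ∪ {x | x ∈ q.support} = {x | x ∈ p.support} := by
  have hcycle := hp.isCycle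
  have hedges := hp.mem_edges
  cases p with
  | nil => exact absurd hcycle (by simp)
  | @cons _ v _ h r =>
    rw [Walk.cons_isCycle_iff] at hcycle
    cases r with
    | nil => exact absurd h (H.loopless.irrefl _)
    | cons h' r' =>
      obtain ⟨w, q, h'', hr⟩ := Walk.exists_cons_eq_concat h' r'
      rw [hr] at hcycle hedges ⊢
      obtain ⟨hq, huq⟩ := (Walk.concat_isPath_iff _).1 hcycle.1
      have hqu : ∀ e ∈ q.edges, e ∈ (isolate H {u}).edgeSet :=
        edges_subset_edgeSet_isolate q fun x hx hxu => huq (hxu ▸ hx)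
      refine ⟨v, w, q.transfer _ hqu, ⟨hq.transfer _, fun x hx z hz => ?_⟩, by simp, ?_⟩
      · have hxu : x ≠ u := hz.2.1
        have hzu : z ≠ u := hz.2.2
        rw [Walk.support_transfer] at hx
        have hmem := hedges x (by simp [Walk.support_concat, hx]) hxu z hz.1
        simpa [Walk.edges_concat, hxu, hzu] using hmem
      · ext x
        simp only [Walk.support_transfer, Walk.support_cons, Walk.support_concat,
          List.mem_cons, List.mem_append, List.not_mem_nil,
          Set.mem_union, Set.mem_singleton_iff, Set.mem_ofPred_eq]
        tauto

variable [Fintype V] {B : Matrix V V ℂ}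

lemma IsLeaf.weightNegIndex_eq {x y : V} (h : IsLeaf H x y) (hB : IsUnitWeight H B) :
    weightNegIndex H B = weightNegIndex (isolate H {y}) B + 1 :=
  (weightNegIndex_le_isolate_singleton_add_one y).antisymm (h.weightNegIndex_isolate_add_one_le hB)

lemma IsPathComponent.weightNegIndex_eq {a b : V} {q : H.Walk a b} (hq : IsPathComponent q)
    (hB : IsUnitWeight H B) :
    weightNegIndex H B =
      weightNegIndex (isolate H {x | x ∈ q.support}) B + (q.length + 1) / 2 := by
  induction hn : q.length using Nat.strong_induction_on generalizing H a with | h n ih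
  match q, hq with
  | .nil, hq =>
    rw [isolate_eq_self, ← hn]
    · simp
    · exact fun x hx z hz => absurd (hq.mem_edges x hx z hz) List.not_mem_nil
  | .cons h .nil, hq =>
    have hpair : {x | x ∈ (Walk.cons h .nil).support} = {a, b} := by ext; simp
    rw [hpair, hq.isLeaf.isolate_pair, hq.isLeaf.weightNegIndex_eq hB, ← hn]
    simp
  | .cons (v := c) h (.cons h' r), hq =>
    obtain ⟨r', hr', hlen, hsupp⟩ := hq.exists_isolate
    have hrest := ih r'.length (by simp [← hn, hlen]) hr' (hB.anti (isolate_le _)) rfl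
    have hset : {x | x ∈ (Walk.cons h (.cons h' r)).support} = {a, c} ∪ {x | x ∈ r.support} := by
      ext x
      simp [or_assoc]
    rw [hset, ← isolate_isolate, hq.isLeaf.isolate_pair, hq.isLeaf.weightNegIndex_eq hB, hrest,
      hsupp, hlen, ← hn]
    simp only [Walk.length_cons]
    lia

lemma IsPendantCycle.weightNegIndex_isolate_singleton_eq {u : V} {p : H.Walk u u}
    (hp : IsPendantCycle p) (hB : IsUnitWeight H B) :
    weightNegIndex (isolate H {u}) B =
      weightNegIndex (isolate H {x | x ∈ p.support}) B + (p.length - 1) / 2 := by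
  obtain ⟨a, b, q, hq, hlen, hsupp⟩ := hp.exists_isPathComponent
  rw [hq.weightNegIndex_eq (hB.anti (isolate_le _)), isolate_isolate, hsupp, ← hlen]
  rfl

end PendantCycles

section OddCycles

variable {V : Type*} {H : SimpleGraph V} {B : Matrix V V ℂ} {u : V} {p : H.Walk u u}

/-- The gain of the first `i` steps of a walk, for gains given by the entries of `B`. -/
noncomputable def partialGain {v : V} (B : Matrix V V ℂ) (p : H.Walk u v) (i : ℕ) : ℂ :=
  ∏ j ∈ Finset.range i, B (p.getVert j) (p.getVert (j + 1))

/-- The closed walk `p` is of Type D, for gains given by the entries of `B`. -/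
def IsTypeDWalk (B : Matrix V V ℂ) (p : H.Walk u u) : Prop :=
  Odd p.length ∧ ((-1 : ℂ) ^ ((p.length - 1) / 2) * partialGain B p p.length).re < 0

/-- The signs alternate along the even and along the odd positions of a cycle of length `2l + 1`;
`φ` is its gain. The exponent at the odd positions makes the values agree at `0` and `2l + 1`. -/
noncomputable def alternatingSign (l : ℕ) (φ : ℂ) (i : ℕ) : ℂ :=
  if Even i then (-1) ^ (i / 2) else (-1) ^ (l + i / 2) * φ

/-- The values along an odd cycle of the vector annihilated by all rows of the adjacency matrix but
that of the base point. -/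
noncomputable def oddCycleCoeff (B : Matrix V V ℂ) (p : H.Walk u u) (i : ℕ) : ℂ :=
  alternatingSign ((p.length - 1) / 2) (partialGain B p p.length) i * star (partialGain B p i)

/-- The vector with values `oddCycleCoeff` on the vertices of `p` and zero elsewhere. -/
noncomputable def oddCycleVector (B : Matrix V V ℂ) (p : H.Walk u u) : V → ℂ :=
  Function.extend (fun i : Fin p.length => p.getVert i) (fun i => oddCycleCoeff B p i) 0

lemma alternatingSign_add_two (l : ℕ) (φ : ℂ) (i : ℕ) :
    alternatingSign l φ (i + 2) = -alternatingSign l φ i := by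
  have hdiv : (i + 2) / 2 = i / 2 + 1 := by lia
  by_cases h : Even i
  · simp [alternatingSign, h, hdiv, Nat.even_add, pow_succ]
  · simp [alternatingSign, h, hdiv, Nat.even_add, pow_succ, ← add_assoc]

lemma star_partialGain_succ (hB : B.IsHermitian) (i : ℕ) :
    star (partialGain B p (i + 1)) =
      B (p.getVert (i + 1)) (p.getVert i) * star (partialGain B p i) := by
  rw [partialGain, Finset.prod_range_succ, star_mul, hB.apply]
  rfl

lemma mul_star_partialGain_succ (hB : IsUnitWeight H B) {i : ℕ} (hi : i < p.length) :
    B (p.getVert i) (p.getVert (i + 1)) * star (partialGain B p (i + 1)) =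
      star (partialGain B p i) := by
  rw [star_partialGain_succ hB.1, ← mul_assoc, hB.mul_eq_one (p.adj_getVert_succ hi), one_mul]

lemma partialGain_mul_star (hB : IsUnitWeight H B) {i : ℕ} (hi : i ≤ p.length) :
    partialGain B p i * star (partialGain B p i) = 1 := by
  induction i with
  | zero => simp [partialGain]
  | succ i ih =>
    rw [← ih (by lia), ← mul_star_partialGain_succ hB hi, ← mul_assoc]
    congr 1
    exact Finset.prod_range_succ _ _

lemma oddCycleCoeff_zero : oddCycleCoeff B p 0 = 1 := by
  simp [oddCycleCoeff, alternatingSign, partialGain]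

lemma oddCycleCoeff_length (hB : IsUnitWeight H B) (hodd : Odd p.length) :
    oddCycleCoeff B p p.length = 1 := by
  have hexp : Even ((p.length - 1) / 2 + p.length / 2) := by
    obtain ⟨l, hl⟩ := hodd
    exact ⟨l, by lia⟩
  rw [oddCycleCoeff, alternatingSign, if_neg (Nat.not_even_iff_odd.2 hodd), hexp.neg_one_pow,
    one_mul, partialGain_mul_star hB le_rfl]

lemma oddCycleCoeff_interior (hB : IsUnitWeight H B) {i : ℕ} (hi : i + 1 < p.length) :
    B (p.getVert (i + 1)) (p.getVert i) * oddCycleCoeff B p i +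
      B (p.getVert (i + 1)) (p.getVert (i + 2)) * oddCycleCoeff B p (i + 2) = 0 := by
  have hback := star_partialGain_succ (p := p) hB.1 i
  have hforth := mul_star_partialGain_succ hB hi
  rw [oddCycleCoeff, oddCycleCoeff, alternatingSign_add_two]
  linear_combination alternatingSign ((p.length - 1) / 2) (partialGain B p p.length) i *
    (-hback - hforth)

lemma oddCycleCoeff_base (hB : IsUnitWeight H B) (hodd : Odd p.length) :
    B u p.snd * oddCycleCoeff B p 1 + B u p.penultimate * oddCycleCoeff B p (p.length - 1) =
      ((2 * ((-1) ^ ((p.length - 1) / 2) * partialGain B p p.length).re : ℝ) : ℂ) := by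
  set φ := partialGain B p p.length with hφ
  set l := (p.length - 1) / 2 with hl
  obtain ⟨m, hm⟩ := hodd
  have hlast : p.length - 1 + 1 = p.length := by lia
  have hfirst : B u p.snd * star (partialGain B p 1) = 1 := by
    simpa [partialGain] using mul_star_partialGain_succ hB (p := p) (i := 0) (by lia)
  have hclosing : B u p.penultimate * star (partialGain B p (p.length - 1)) = star φ := by
    simpa [hlast] using (star_partialGain_succ (p := p) hB.1 (p.length - 1)).symm
  have hsign_one : alternatingSign l φ 1 = (-1) ^ l * φ := by simp [alternatingSign]
  have hsign_last : alternatingSign l φ (p.length - 1) = (-1) ^ l := by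
    rw [alternatingSign, if_pos ⟨m, by lia⟩]
  rw [oddCycleCoeff, oddCycleCoeff, ← hφ, ← hl, hsign_one, hsign_last]
  calc _ = (-1) ^ l * φ + (-1) ^ l * star φ := by
        linear_combination (-1) ^ l * φ * hfirst + (-1) ^ l * hclosing
    _ = (-1) ^ l * φ + star ((-1) ^ l * φ) := by simp
    _ = _ := Complex.add_conj _

lemma oddCycleVector_getVert (hp : p.IsCycle) (hB : IsUnitWeight H B) (hodd : Odd p.length)
    {i : ℕ} (hi : i ≤ p.length) : oddCycleVector B p (p.getVert i) = oddCycleCoeff B p i := by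
  have hinj : Function.Injective fun i : Fin p.length => p.getVert i := fun i j hij =>
    Fin.ext (hp.getVert_injOn' (by simp; lia) (by simp; lia) hij)
  have hlt : ∀ i < p.length, oddCycleVector B p (p.getVert i) = oddCycleCoeff B p i :=
    fun i hi => hinj.extend_apply _ _ ⟨i, hi⟩
  rcases hi.lt_or_eq with hi | rfl
  · exact hlt i hi
  · rw [oddCycleCoeff_length hB hodd, ← oddCycleCoeff_zero (B := B) (p := p), ← hlt 0 hodd.pos]
    simp

lemma oddCycleVector_of_notMem {x : V} (hx : x ∉ p.support) : oddCycleVector B p x = 0 :=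
  Function.extend_apply' _ _ _ fun ⟨i, hi⟩ => hx (hi ▸ p.getVert_mem_support i)

lemma IsIsolatedCycle.neighborSet_eq (hp : IsIsolatedCycle p) {x : V} (hx : x ∈ p.support) :
    H.neighborSet x = p.toSubgraph.neighborSet x := by
  ext z
  rw [mem_neighborSet, Subgraph.mem_neighborSet, Walk.adj_toSubgraph_iff_mem_edges]
  exact ⟨hp.mem_edges x hx z, p.adj_of_mem_edges⟩

variable [Fintype V]

lemma mulVec_weightMatrix_apply {x a b : V} (hab : a ≠ b) (h : H.neighborSet x = {a, b})
    (z : V → ℂ) : (weightMatrix H B *ᵥ z) x = B x a * z a + B x b * z b := by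
  have hadj : ∀ c, H.Adj x c ↔ c = a ∨ c = b := fun c => Set.ext_iff.1 h c
  rw [mulVec, dotProduct, Finset.sum_eq_add a b hab, weightMatrix_of_adj ((hadj a).2 (.inl rfl)),
    weightMatrix_of_adj ((hadj b).2 (.inr rfl))]
  · intro c _ hc
    rw [weightMatrix_of_not_adj fun h => ((hadj c).1 h).elim hc.1 hc.2, zero_mul]
  · exact fun h => absurd (Finset.mem_univ _) h
  · exact fun h => absurd (Finset.mem_univ _) h

lemma IsIsolatedCycle.mulVec_oddCycleVector_of_ne (hp : IsIsolatedCycle p)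
    (hB : IsUnitWeight H B) (hodd : Odd p.length) {x : V} (hx : x ≠ u) :
    (weightMatrix H B *ᵥ oddCycleVector B p) x = 0 := by
  by_cases hxp : x ∈ p.support
  · obtain ⟨i, rfl, hi⟩ := Walk.mem_support_iff_exists_getVert.1 hxp
    have hi0 : i ≠ 0 := by
      rintro rfl
      exact hx p.getVert_zero
    have hil : i ≠ p.length := by
      rintro rfl
      exact hx p.getVert_length
    obtain ⟨j, rfl⟩ := Nat.exists_eq_succ_of_ne_zero hi0
    have hnbr := hp.neighborSet_eq hxp
    rw [hp.isCycle.neighborSet_toSubgraph_internal hi0 (by lia)] at hnbr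
    rw [mulVec_weightMatrix_apply (hp.isCycle.getVert_sub_one_ne_getVert_add_one hi) hnbr,
      oddCycleVector_getVert hp.isCycle hB hodd (by lia),
      oddCycleVector_getVert hp.isCycle hB hodd (by lia)]
    exact oddCycleCoeff_interior hB (by lia)
  · refine Finset.sum_eq_zero fun z _ => ?_
    by_cases hz : z ∈ p.support
    · exact mul_eq_zero_of_left (weightMatrix_of_not_adj fun hxz =>
        hxp (p.snd_mem_support_of_mem_edges (hp.mem_edges z hz x hxz.symm))) _
    · exact mul_eq_zero_of_right _ (oddCycleVector_of_notMem hz)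

lemma IsIsolatedCycle.hermForm_oddCycleVector (hp : IsIsolatedCycle p)
    (hB : IsUnitWeight H B) (hodd : Odd p.length) :
    hermForm (weightMatrix H B) (oddCycleVector B p) =
      2 * ((-1 : ℂ) ^ ((p.length - 1) / 2) * partialGain B p p.length).re := by
  have hval : ∀ {i}, i ≤ p.length → oddCycleVector B p (p.getVert i) = oddCycleCoeff B p i :=
    oddCycleVector_getVert hp.isCycle hB hodd
  have hnbr := hp.neighborSet_eq p.start_mem_support
  rw [hp.isCycle.neighborSet_toSubgraph_endpoint] at hnbr
  have hbase : oddCycleVector B p u = 1 := by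
    simpa [oddCycleCoeff_zero] using hval (Nat.zero_le _)
  have hrow := mulVec_weightMatrix_apply (B := B) hp.isCycle.snd_ne_penultimate hnbr
    (oddCycleVector B p)
  rw [hval hodd.pos, hval (Nat.sub_le _ _), oddCycleCoeff_base hB hodd] at hrow
  rw [hermForm, dotProduct, Finset.sum_eq_single u, hrow, Pi.star_apply, hbase]
  · simp
  · intro x _ hx
    rw [hp.mulVec_oddCycleVector_of_ne hB hodd hx, mul_zero]
  · exact fun h => absurd (Finset.mem_univ _) h

theorem IsIsolatedCycle.weightNegIndex_isolate_add_le (hp : IsIsolatedCycle p)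
    (hB : IsUnitWeight H B) (hD : IsTypeDWalk B p) :
    weightNegIndex (isolate H {x | x ∈ p.support}) B + (p.length + 1) / 2 ≤
      weightNegIndex H B := by
  have hbase : weightNegIndex (isolate H {u}) B + 1 ≤ weightNegIndex H B := by
    rw [weightNegIndex, weightMatrix_isolate]
    refine negIndex_zeroOn_singleton_add_one_le (isHermitian_weightMatrix hB.1)
      (fun w => hp.mulVec_oddCycleVector_of_ne hB hD.1) ?_
    rw [hp.hermForm_oddCycleVector hB hD.1]
    linarith [hD.2]
  rw [hp.isPendantCycle.weightNegIndex_isolate_singleton_eq hB] at hbase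
  have := hp.isCycle.three_le_length
  lia

theorem IsIsolatedCycle.weightNegIndex_le_isolate_add (hp : IsIsolatedCycle p)
    (hB : IsUnitWeight H B) (hodd : Odd p.length) (hD : ¬ IsTypeDWalk B p) :
    weightNegIndex H B ≤
      weightNegIndex (isolate H {x | x ∈ p.support}) B + (p.length - 1) / 2 := by
  have hbase : weightNegIndex H B ≤ weightNegIndex (isolate H {u}) B := by
    rw [weightNegIndex, weightNegIndex, weightMatrix_isolate]
    refine negIndex_le_negIndex_zeroOn_singleton (isHermitian_weightMatrix hB.1)
      (g := oddCycleVector B p) ?_ (fun w => hp.mulVec_oddCycleVector_of_ne hB hodd) ?_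
    · simpa [oddCycleCoeff_zero] using
        oddCycleVector_getVert hp.isCycle hB hodd (Nat.zero_le p.length)
    · rw [hp.hermForm_oddCycleVector hB hodd]
      linarith [not_lt.1 fun h => hD ⟨hodd, h⟩]
  rwa [hp.isPendantCycle.weightNegIndex_isolate_singleton_eq hB] at hbase

end OddCycles

section CycleUnions

variable {V : Type*} {G H : SimpleGraph V} {B : Matrix V V ℂ}

lemma mem_edges_of_not_isBridge (hG : G.DisjointCycles) {u x z : V} {p : G.Walk u u}
    (hp : p.IsCycle) (hx : x ∈ p.support) (hxz : G.Adj x z) (hb : ¬ G.IsBridge s(x, z)) :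
    s(x, z) ∈ p.edges := by
  obtain ⟨v, q, hq, he⟩ := exists_isCycle_of_not_isBridge hxz hb
  exact disjointCycles_iff.1 hG q p hq hp x (q.fst_mem_support_of_mem_edges he) hx _ he

lemma not_isBridge_isolate {u : V} {p : G.Walk u u} (hp : p.IsCycle) {S : Set V}
    (h : ∀ x ∈ p.support, x ∉ S) {e : Sym2 V} (he : e ∈ p.edges) : ¬ (isolate G S).IsBridge e :=
  not_isBridge_of_mem_edges (hp.transfer (edges_subset_edgeSet_isolate p h))
    (by rwa [Walk.edges_transfer])

lemma cyclomaticNumber_le_isolate_support_add_one [Finite V] (hG : G.DisjointCycles) {u : V}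
    {p : G.Walk u u} (hp : p.IsCycle) :
    G.cyclomaticNumber ≤ (isolate G {x | x ∈ p.support}).cyclomaticNumber + 1 := by
  obtain ⟨y, hy⟩ := exists_mem_edges_of_isCycle hp p.start_mem_support
  rw [← cyclomaticNumber_deleteEdges_of_not_isBridge (p.edges_subset_edgeSet hy)
    (not_isBridge_of_mem_edges hp hy), add_le_add_iff_right]
  refine cyclomaticNumber_le_of_isBridge (isolate_le_deleteEdges p.start_mem_support) ?_
  intro f hf hfp
  by_contra hb
  obtain ⟨v, q, hq, hfq⟩ := exists_isCycle_of_not_isBridge hf hb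
  have hle := deleteEdges_le (G := G) {s(u, y)}
  obtain ⟨x, hxq, hxp⟩ : ∃ x ∈ q.support, x ∈ p.support := by
    by_contra! hdisj
    exact hfp (edges_subset_edgeSet_isolate (q.mapLe hle) (by simpa using hdisj) f
      (by simpa using hfq))
  have hyq := disjointCycles_iff.1 hG p (q.mapLe hle) hp ((Walk.isCycle_mapLe hle).2 hq) x hxp
    (by simpa using hxq) _ hy
  rw [Walk.edges_mapLe_eq_edges] at hyq
  have hmem := q.edges_subset_edgeSet hyq
  rw [edgeSet_deleteEdges] at hmem
  exact hmem.2 rfl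

lemma matchingNumber_bot [Finite V] : (⊥ : SimpleGraph V).matchingNumber = 0 := by
  obtain ⟨M, hM, hcard⟩ := exists_isMatchingSet_card_eq (⊥ : SimpleGraph V)
  have hempty : M = ∅ := Finset.eq_empty_of_forall_notMem fun e he => by simpa using hM.1 e he
  rw [← hcard, hempty, Finset.card_empty]

lemma IsIsolatedCycle.matchingNumber_le [Finite V] {u : V} {p : H.Walk u u}
    (hp : IsIsolatedCycle p) :
    H.matchingNumber ≤ (isolate H {x | x ∈ p.support}).matchingNumber + p.length / 2 := by
  classical
  have hsupp : {x | x ∈ p.support} = (p.support.tail.toFinset : Set V) := by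
    ext x
    simpa [p.mem_support_iff] using
      fun hx : x = u => hx ▸ Walk.end_mem_tail_support hp.isCycle.not_nil
  have hcard : {x | x ∈ p.support}.ncard ≤ p.length := by
    rw [hsupp, Set.ncard_coe_finset]
    exact (List.toFinset_card_le _).trans (by simp)
  have hle := matchingNumber_le_isolate_add_half_ncard (G := H) (K := {x | x ∈ p.support})
    fun a b hab ha => p.snd_mem_support_of_mem_edges (hp.mem_edges a ha b hab)
  lia

/-- A disjoint union of cycles and isolated vertices. -/
structure IsCycleUnion (H : SimpleGraph V) : Prop where
  disjointCycles : H.DisjointCycles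
  not_isBridge : ∀ ⦃x y⦄, H.Adj x y → ¬ H.IsBridge s(x, y)

lemma isCycleUnion_cyclePart (hG : G.DisjointCycles) : IsCycleUnion (cyclePart G) where
  disjointCycles := disjointCycles_anti cyclePart_le hG
  not_isBridge a b hcp := by
    obtain ⟨hab, hb⟩ := cyclePart_adj.1 hcp
    obtain ⟨u, p, hp, hep⟩ := exists_isCycle_of_not_isBridge hab hb
    exact not_isBridge_of_mem_edges (hp.transfer (edges_subset_edgeSet_cyclePart hp))
      (by rwa [Walk.edges_transfer])

lemma isCycleUnion_isolate (hG : G.DisjointCycles) {S : Set V}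
    (hS : ∀ a b, (isolate G S).Adj a b → ∃ (u : V) (p : G.Walk u u), p.IsCycle ∧
      s(a, b) ∈ p.edges ∧ ∀ x ∈ p.support, x ∉ S) : IsCycleUnion (isolate G S) where
  disjointCycles := disjointCycles_anti (isolate_le S) hG
  not_isBridge a b hab := by
    obtain ⟨u, p, hp, hep, hpS⟩ := hS a b hab
    exact not_isBridge_isolate hp hpS hep

namespace IsCycleUnion

lemma exists_isCycle (hH : IsCycleUnion H) (hne : H ≠ ⊥) :
    ∃ (u : V) (p : H.Walk u u), p.IsCycle := by
  obtain ⟨a, b, hab⟩ := ne_bot_iff_exists_adj.1 hne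
  obtain ⟨u, p, hp, -⟩ := exists_isCycle_of_not_isBridge hab (hH.not_isBridge hab)
  exact ⟨u, p, hp⟩

lemma isIsolatedCycle (hH : IsCycleUnion H) {u : V} {p : H.Walk u u} (hp : p.IsCycle) :
    IsIsolatedCycle p :=
  ⟨hp, fun _ hx _ hxz => mem_edges_of_not_isBridge hH.disjointCycles hp hx hxz
    (hH.not_isBridge hxz)⟩

lemma isolate_support (hH : IsCycleUnion H) {u : V} {p : H.Walk u u} (hp : p.IsCycle) :
    IsCycleUnion (isolate H {x | x ∈ p.support}) := by
  refine isCycleUnion_isolate hH.disjointCycles ?_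
  rintro a b ⟨hab, ha, -⟩
  obtain ⟨v, q, hq, heq⟩ := exists_isCycle_of_not_isBridge hab (hH.not_isBridge hab)
  refine ⟨v, q, hq, heq, fun x hxq hxp => ha ?_⟩
  exact p.fst_mem_support_of_mem_edges
    (disjointCycles_iff.1 hH.disjointCycles q p hq hp x hxq hxp _ heq)

end IsCycleUnion

lemma isTypeDWalk_congr {u : V} {p : H.Walk u u} {q : G.Walk u u} (h : p.support = q.support) :
    IsTypeDWalk B p ↔ IsTypeDWalk B q := by
  have hlen : p.length = q.length := by
    simpa only [Walk.length_support, add_left_inj] using congrArg List.length h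
  have hvert (i : ℕ) : p.getVert i = q.getVert i := by
    rw [Walk.getVert_eq_getD_support, Walk.getVert_eq_getD_support, h]
  simp only [IsTypeDWalk, partialGain, hlen, hvert]

/-- All cycles of `G` are of Type D, for gains given by the entries of `B`. -/
def AllTypeD (G : SimpleGraph V) (B : Matrix V V ℂ) : Prop :=
  ∀ ⦃u : V⦄ (p : G.Walk u u), p.IsCycle → IsTypeDWalk B p

lemma AllTypeD.anti (hG : AllTypeD G B) (h : H ≤ G) : AllTypeD H B := fun _ p hp =>
  (isTypeDWalk_congr (p.support_mapLe_eq_support h)).1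
    (hG (p.mapLe h) ((Walk.isCycle_mapLe h).2 hp))

variable [Fintype V]

theorem IsCycleUnion.attainsBound (hH : IsCycleUnion H) (hD : AllTypeD H B)
    (hB : IsUnitWeight H B) : AttainsBound H B := by
  induction H using WellFoundedLT.induction with | ind H ih
  rcases eq_or_ne H ⊥ with rfl | hne
  · simp [AttainsBound, weightNegIndex_bot, matchingNumber_bot, cyclomaticNumber_bot]
  obtain ⟨u, p, hp⟩ := hH.exists_isCycle hne
  have hle : isolate H {x | x ∈ p.support} ≤ H := isolate_le _
  have hrest := ih _ (isolate_lt (p.adj_snd hp.not_nil) p.start_mem_support)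
    (hH.isolate_support hp) (hD.anti hle) (hB.anti hle)
  have hcyc := hH.isIsolatedCycle hp
  have hneg := hcyc.weightNegIndex_isolate_add_le hB (hD p hp)
  have hmatch := hcyc.matchingNumber_le
  have hcyclomatic := cyclomaticNumber_le_isolate_support_add_one hH.disjointCycles hp
  have hbound := weightNegIndex_le_matchingNumber_add_cyclomaticNumber (B := B) H
  obtain ⟨l, hl⟩ := (hD p hp).1
  unfold AttainsBound at hrest ⊢
  lia

theorem attainsBound_of_isMatchedSet (hG : G.DisjointCycles) (hD : AllTypeD G B)
    (hB : IsUnitWeight G B) {K : Set V} {π : V → V} (hK : IsMatchedSet G K π)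
    (hKO : Disjoint K G.cycleVerts) (hπO : ∀ y ∈ K, π y ∉ G.cycleVerts)
    (hcov : ∀ a b, G.Adj a b → G.IsBridge s(a, b) → a ∈ K ∨ b ∈ K) : AttainsBound G B := by
  have hle : isolate G K ≤ G := isolate_le K
  have hac : (matchedPart G K π).IsAcyclic := by
    intro u p hp
    have huO : u ∈ G.cycleVerts := cycleVerts_mono (isolate_le _)
      (mem_cycleVerts_iff.2 ⟨u, p, hp, p.start_mem_support⟩)
    rcases not_not.1 (p.adj_snd hp.not_nil).2.1 with hu | ⟨y, hy, rfl⟩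
    · exact hKO.notMem_of_mem_left hu huO
    · exact hπO y hy huO
  have hunion : IsCycleUnion (isolate G K) := isCycleUnion_isolate hG <| by
    rintro a b ⟨hab, ha, hb⟩
    obtain ⟨u, p, hp, hep⟩ := exists_isCycle_of_not_isBridge hab
      fun hbr => (hcov a b hab hbr).elim ha hb
    exact ⟨u, p, hp, hep, fun x hx =>
      hKO.notMem_of_mem_right (mem_cycleVerts_iff.2 ⟨u, p, hp, hx⟩)⟩
  have hrest := hunion.attainsBound (hD.anti hle) (hB.anti hle)
  have hneg := hK.ncard_add_weightNegIndex_isolate_le hac hB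
  have hmatch := matchingNumber_le_isolate_add_ncard (G := G) K
  have hcyclomatic : G.cyclomaticNumber ≤ (isolate G K).cyclomaticNumber := by
    refine cyclomaticNumber_le_of_isBridge hle ?_
    refine Sym2.ind fun a b hab hmem => ?_
    by_cases ha : a ∈ K
    · exact isBridge_of_notMem_cycleVerts hab (hKO.notMem_of_mem_left ha)
    by_cases hb : b ∈ K
    · rw [Sym2.eq_swap]
      exact isBridge_of_notMem_cycleVerts hab.symm (hKO.notMem_of_mem_left hb)
    · exact absurd ⟨hab, ha, hb⟩ hmem
  have hbound := weightNegIndex_le_matchingNumber_add_cyclomaticNumber (B := B) G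
  unfold AttainsBound at hrest ⊢
  lia

end CycleUnions

section Contraction

variable {V α : Type*} {G : SimpleGraph V}

/-- The vertex of the contracted graph `G.contractCycles` onto which `v` is contracted. -/
def cycleClass (G : SimpleGraph V) (v : V) : Quotient G.cycleSetoid := Quotient.mk _ v

lemma cycleClass_eq_of_mem_support {u a b : V} {p : G.Walk u u} (hp : p.IsCycle)
    (ha : a ∈ p.support) (hb : b ∈ p.support) : cycleClass G a = cycleClass G b :=
  Quotient.sound (Relation.EqvGen.rel _ _ ⟨_, ⟨u, p, hp, rfl⟩, p.mem_verts_toSubgraph.2 ha,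
    p.mem_verts_toSubgraph.2 hb⟩)

lemma apply_eq_of_cycleClass_eq {f : V → α}
    (hf : ∀ ⦃u : V⦄ (p : G.Walk u u), p.IsCycle → ∀ a ∈ p.support, f a = f u) {a b : V}
    (h : cycleClass G a = cycleClass G b) : f a = f b := by
  have hle : G.cycleSetoid ≤ Setoid.ker f := by
    refine Setoid.eqvGen_le ?_
    rintro x y ⟨_, ⟨u, p, hp, rfl⟩, hx, hy⟩
    exact (hf p hp x (p.mem_verts_toSubgraph.1 hx)).trans
      (hf p hp y (p.mem_verts_toSubgraph.1 hy)).symm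
  exact hle (Quotient.exact h)

lemma eq_of_cycleClass_eq {a b : V} (ha : a ∉ G.cycleVerts) (h : cycleClass G a = cycleClass G b) :
    a = b := by
  classical
  have hf := apply_eq_of_cycleClass_eq (f := fun v => if v ∈ G.cycleVerts then none else some v)
    (fun u p hp x hx => by
      rw [if_pos (mem_cycleVerts_iff.2 ⟨u, p, hp, hx⟩),
        if_pos (mem_cycleVerts_iff.2 ⟨u, p, hp, p.start_mem_support⟩)]) h
  by_cases hb : b ∈ G.cycleVerts
  · simp [ha, hb] at hf
  · simpa [ha, hb] using hf

lemma connectedComponentMk_eq_of_cycleClass_eq {e : Sym2 V} (he : G.IsBridge e) {a b : V}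
    (h : cycleClass G a = cycleClass G b) :
    (G.deleteEdges {e}).connectedComponentMk a = (G.deleteEdges {e}).connectedComponentMk b := by
  classical
  refine apply_eq_of_cycleClass_eq (fun u p hp x hx => ?_) h
  have hpe : ∀ f ∈ p.edges, f ∈ (G.deleteEdges {e}).edgeSet := fun f hf => by
    rw [edgeSet_deleteEdges]
    refine ⟨p.edges_subset_edgeSet hf, ?_⟩
    rintro rfl
    exact not_isBridge_of_mem_edges hp hf he
  have hreach : (G.deleteEdges {e}).Reachable u x :=
    ⟨(p.transfer _ hpe).takeUntil x (by rwa [Walk.support_transfer])⟩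
  exact ConnectedComponent.sound hreach.symm

lemma isBridge_iff_cycleClass_ne {a b : V} (hab : G.Adj a b) :
    G.IsBridge s(a, b) ↔ cycleClass G a ≠ cycleClass G b := by
  refine ⟨fun hb h => isBridge_iff.1 hb
    (ConnectedComponent.exact (connectedComponentMk_eq_of_cycleClass_eq hb h)), fun h => ?_⟩
  by_contra hb
  obtain ⟨u, p, hp, he⟩ := exists_isCycle_of_not_isBridge hab hb
  exact h (cycleClass_eq_of_mem_support hp (p.fst_mem_support_of_mem_edges he)
    (p.snd_mem_support_of_mem_edges he))

lemma contractCycles_adj {X Y : Quotient G.cycleSetoid} : G.contractCycles.Adj X Y ↔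
    ∃ a b, G.Adj a b ∧ G.IsBridge s(a, b) ∧ cycleClass G a = X ∧ cycleClass G b = Y := by
  constructor
  · rintro ⟨hne, a, b, hab, rfl, rfl⟩
    exact ⟨a, b, hab, (isBridge_iff_cycleClass_ne hab).2 hne, rfl, rfl⟩
  · rintro ⟨a, b, hab, hb, rfl, rfl⟩
    exact ⟨(isBridge_iff_cycleClass_ne hab).1 hb, a, b, hab, rfl, rfl⟩

lemma eq_and_eq_of_cycleClass_eq {a b c d : V} (hab : G.Adj a b) (hcd : G.Adj c d)
    (hb : G.IsBridge s(a, b)) (hca : cycleClass G c = cycleClass G a)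
    (hdb : cycleClass G d = cycleClass G b) : c = a ∧ d = b := by
  by_cases he : s(c, d) = s(a, b)
  · rcases Sym2.eq_iff.1 he with h | ⟨rfl, rfl⟩
    · exact h
    · exact absurd hca.symm ((isBridge_iff_cycleClass_ne hab).1 hb)
  · have hreach : (G.deleteEdges {s(a, b)}).Reachable c d :=
      (deleteEdges_adj.2 ⟨hcd, he⟩ : (G.deleteEdges {s(a, b)}).Adj c d).reachable
    refine absurd (ConnectedComponent.exact ?_) (isBridge_iff.1 hb)
    rw [← connectedComponentMk_eq_of_cycleClass_eq hb hca,
      ← connectedComponentMk_eq_of_cycleClass_eq hb hdb, ConnectedComponent.sound hreach]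

lemma contractCycles_isAcyclic (G : SimpleGraph V) : G.contractCycles.IsAcyclic := by
  rw [isAcyclic_iff_forall_adj_isBridge]
  intro X Y hXY
  obtain ⟨a, b, -, hb, rfl, rfl⟩ := contractCycles_adj.1 hXY
  let f : Quotient G.cycleSetoid → (G.deleteEdges {s(a, b)}).ConnectedComponent :=
    Quotient.lift _ fun _ _ h => connectedComponentMk_eq_of_cycleClass_eq hb (Quotient.sound h)
  have hf (X Y) (h : (G.contractCycles.deleteEdges {s(cycleClass G a, cycleClass G b)}).Adj X Y) :
      f X = f Y := by
    rw [deleteEdges_adj] at h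
    obtain ⟨x, y, hxy, -, rfl, rfl⟩ := contractCycles_adj.1 h.1
    refine ConnectedComponent.sound (Adj.reachable (deleteEdges_adj.2 ⟨hxy, fun he => h.2 ?_⟩))
    exact congrArg (Sym2.map (cycleClass G)) he
  rw [isBridge_iff]
  intro hreach
  exact isBridge_iff.1 hb (ConnectedComponent.exact (eq_of_reachable hf hreach))

/-- `p` traverses a cycle which is joined to the rest of `G` by a single edge, from the base point
to `w`. -/
structure IsLeafCycle {u : V} (p : G.Walk u u) (w : V) : Prop where
  isCycle : p.IsCycle
  adj : G.Adj u w
  notMem : w ∉ p.support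
  mem_edges : ∀ x ∈ p.support, ∀ z, G.Adj x z → s(x, z) ∈ p.edges ∨ x = u ∧ z = w

lemma IsLeafCycle.isPendantCycle {u w : V} {p : G.Walk u u} (hp : IsLeafCycle p w) :
    IsPendantCycle p :=
  ⟨hp.isCycle, fun x hx hxu z hz => (hp.mem_edges x hx z hz).resolve_right fun h => hxu h.1⟩

/-- A leaf of the contracted graph is a leaf of `G` or contracted from a leaf cycle. -/
lemma exists_isLeaf_or_isIsolatedCycle_or_isLeafCycle [Finite V] (hG : G.DisjointCycles)
    (hne : G ≠ ⊥) :
    (∃ x y, IsLeaf G x y) ∨ (∃ (u : V) (p : G.Walk u u), IsIsolatedCycle p) ∨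
      ∃ (u w : V) (p : G.Walk u u), IsLeafCycle p w := by
  classical
  rcases eq_or_ne G.contractCycles ⊥ with hbot | hT
  · have hH : IsCycleUnion G := ⟨hG, fun a b hab hb => by
      simpa [hbot] using contractCycles_adj.2 ⟨a, b, hab, hb, rfl, rfl⟩⟩
    obtain ⟨u, p, hp⟩ := hH.exists_isCycle hne
    exact Or.inr (Or.inl ⟨u, p, hH.isIsolatedCycle hp⟩)
  obtain ⟨_, _, hXY, hleaf⟩ := exists_isLeaf_of_isAcyclic (contractCycles_isAcyclic G) hT
  obtain ⟨a, b, hab, hb, rfl, rfl⟩ := contractCycles_adj.1 hXY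
  have hexit {x z : V} (hxa : cycleClass G x = cycleClass G a) (hxz : G.Adj x z)
      (hbr : G.IsBridge s(x, z)) : x = a ∧ z = b :=
    eq_and_eq_of_cycleClass_eq hab hxz hb hxa
      (hleaf _ (contractCycles_adj.2 ⟨x, z, hxz, hbr, hxa, rfl⟩))
  by_cases ha : a ∈ G.cycleVerts
  · obtain ⟨v, q, hq, haq⟩ := mem_cycleVerts_iff.1 ha
    have hp := (Walk.isCycle_rotate haq).2 hq
    refine Or.inr (Or.inr ⟨a, b, q.rotate a haq, hp, hab, fun hbp => hXY.ne
      (cycleClass_eq_of_mem_support hp (Walk.start_mem_support _) hbp), fun x hx z hxz => ?_⟩)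
    by_cases hbr : G.IsBridge s(x, z)
    · exact Or.inr (hexit (cycleClass_eq_of_mem_support hp hx (Walk.start_mem_support _)) hxz hbr)
    · exact Or.inl (mem_edges_of_not_isBridge hG hp hx hxz hbr)
  · exact Or.inl ⟨a, b, hab, fun z hz =>
      (hexit rfl hz (isBridge_of_notMem_cycleVerts hz ha)).2⟩

lemma matchingNumber_isolate_cycleVerts_le [Finite V] (G : SimpleGraph V) :
    (isolate G G.cycleVerts).matchingNumber ≤ G.contractCycles.matchingNumber := by
  refine matchingNumber_le_of_injOn_support (cycleClass G)
    (fun a b hab => contractCycles_adj.2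
      ⟨a, b, hab.1, isBridge_of_notMem_cycleVerts hab.1 hab.2.1, rfl, rfl⟩) ?_
  rintro a ⟨c, hac⟩ b - h
  exact eq_of_cycleClass_eq hac.2.1 h

end Contraction

section ContractionMatchings

variable {V : Type*} [Finite V] {G H : SimpleGraph V}

lemma IsMatchingSet.exists_mem_of_ncard_le {M : Finset (Sym2 V)} (hM : IsMatchingSet G M)
    {K : Set V} (hcov : ∀ e ∈ M, ∃ v ∈ e, v ∈ K) (hcard : K.ncard ≤ M.card) {y : V} (hy : y ∈ K) :
    ∃ x, s(x, y) ∈ M ∧ x ∉ K := by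
  by_contra! hmem
  refine (hM.card_le_ncard (K := K \ {y}) (Set.toFinite _) fun e he => ?_).not_gt
    ((Set.ncard_sdiff_singleton_lt_of_mem hy).trans_le hcard)
  obtain ⟨v, hve, hvK⟩ := hcov e he
  rcases eq_or_ne v y with rfl | hvy
  · obtain ⟨x, rfl⟩ := Sym2.mem_iff_exists.1 hve
    exact ⟨x, Sym2.mem_mk_right v x, hmem x (by rwa [Sym2.eq_swap]), (hM.1 _ he).ne'⟩
  · exact ⟨v, hve, hvK, hvy⟩

lemma IsMatchingSet.exists_isMatchedSet {M : Finset (Sym2 V)} (hM : IsMatchingSet G M) {K : Set V}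
    (hcov : ∀ e ∈ M, ∃ v ∈ e, v ∈ K) (hcard : K.ncard ≤ M.card)
    (hK : ∀ a b c, s(a, b) ∈ M → G.Adj a c → a ∈ K ∨ c ∈ K) :
    ∃ π : V → V, IsMatchedSet G K π ∧ ∀ y ∈ K, s(π y, y) ∈ M := by
  choose! π hπM hπK using fun y => hM.exists_mem_of_ncard_le hcov hcard (y := y)
  refine ⟨π, ⟨fun y hy z hz hyz => ?_, hπK, fun y hy => hM.1 _ (hπM y hy), fun y hy z hz =>
    (hK _ _ z (hπM y hy) hz).resolve_left (hπK y hy)⟩, hπM⟩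
  refine Sym2.congr_right.1 ((hM.2 _ (hπM y hy) _ (hπM z hz) (π y) (Sym2.mem_mk_left _ _) ?_).trans
    (by rw [hyz]))
  exact hyz ▸ Sym2.mem_mk_left _ _

lemma exists_isMatchedSet_of_matchingNumber_le
    (h : G.contractCycles.matchingNumber ≤ (isolate G G.cycleVerts).matchingNumber) :
    ∃ (K : Set V) (π : V → V), IsMatchedSet G K π ∧ Disjoint K G.cycleVerts ∧
      (∀ y ∈ K, π y ∉ G.cycleVerts) ∧
      ∀ a b, G.Adj a b → G.IsBridge s(a, b) → a ∈ K ∨ b ∈ K := by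
  obtain ⟨L, hL, hLcard⟩ := exists_isVertexCover_of_isAcyclic (contractCycles_isAcyclic G)
  obtain ⟨M, hM, hMcard⟩ := exists_isMatchingSet_card_eq (isolate G G.cycleVerts)
  have hMG : IsMatchingSet G M := ⟨fun e he => edgeSet_mono (isolate_le _) (hM.1 e he), hM.2⟩
  have hMO {a b : V} (hab : s(a, b) ∈ M) : G.Adj a b ∧ a ∉ G.cycleVerts ∧ b ∉ G.cycleVerts :=
    hM.1 _ hab
  have hbridge {a b : V} (hab : G.Adj a b) (hb : G.IsBridge s(a, b)) :
      cycleClass G a ∈ L ∨ cycleClass G b ∈ L :=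
    hL (contractCycles_adj.2 ⟨a, b, hab, hb, rfl, rfl⟩)
  let K : Set V := {v | v ∉ G.cycleVerts ∧ cycleClass G v ∈ L}
  have hinj : Set.InjOn (cycleClass G) K := fun a ha b _ hab => eq_of_cycleClass_eq ha.1 hab
  have himage : cycleClass G '' K ⊆ L := by
    rintro _ ⟨v, hv, rfl⟩
    exact hv.2
  have hcovM : ∀ e ∈ M, ∃ v ∈ e, v ∈ K := by
    rintro ⟨a, b⟩ hab
    obtain ⟨hadj, ha, hb⟩ := hMO hab
    rcases hbridge hadj (isBridge_of_notMem_cycleVerts hadj ha) with h | h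
    · exact ⟨a, Sym2.mem_mk_left a b, ha, h⟩
    · exact ⟨b, Sym2.mem_mk_right a b, hb, h⟩
  have hKM : K.ncard ≤ M.card := by
    rw [← hinj.ncard_image, hMcard]
    exact ((Set.ncard_le_ncard himage).trans hLcard).trans h
  have hLK : cycleClass G '' K = L := by
    refine Set.eq_of_subset_of_ncard_le himage ?_
    rw [hinj.ncard_image]
    exact hLcard.trans (h.trans (hMcard ▸ hM.card_le_ncard (Set.toFinite K) hcovM))
  have hmem {v : V} (hv : cycleClass G v ∈ L) : v ∈ K := by
    rw [← hLK] at hv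
    obtain ⟨w, hw, hwv⟩ := hv
    exact eq_of_cycleClass_eq hw.1 hwv ▸ hw
  have hcov (a b : V) (hab : G.Adj a b) (hb : G.IsBridge s(a, b)) : a ∈ K ∨ b ∈ K :=
    (hbridge hab hb).imp hmem hmem
  obtain ⟨π, hπ, hπM⟩ := hMG.exists_isMatchedSet hcovM hKM fun a b c hab hac =>
    hcov a c hac (isBridge_of_notMem_cycleVerts hac (hMO hab).2.1)
  exact ⟨K, π, hπ, Set.disjoint_left.2 fun v hv => hv.1, fun y hy => (hMO (hπM y hy)).2.1, hcov⟩

lemma matchingNumber_isolate_support_add_le_of_odd {u : V} {p : H.Walk u u} (hp : p.IsCycle)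
    (hodd : Odd p.length) {S : Set V} (hS : ∀ x ∈ p.support, x ∈ S → x = u) :
    (isolate H (S ∪ {x | x ∈ p.support})).matchingNumber + p.length / 2 ≤
      (isolate H S).matchingNumber := by
  have hpath := hp.isPath_tail
  have hnil : ¬ p.tail.Nil := by
    rw [← Walk.length_eq_zero_iff, Walk.length_tail]
    have := hp.three_le_length
    lia
  have hsupp := Walk.support_dropLast_concat hnil
  have hu : u ∉ p.tail.dropLast.support := fun hu =>
    List.disjoint_of_nodup_append (hsupp ▸ hpath.support_nodup) hu (List.mem_singleton_self u)
  have hmem {x : V} (hx : x ∈ p.tail.dropLast.support) : x ∈ p.support :=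
    Walk.cons_support_tail hp.not_nil ▸
      List.mem_cons_of_mem u (hsupp ▸ List.mem_append_left _ hx)
  have hedges := edges_subset_edgeSet_isolate p.tail.dropLast (S := S) fun x hx hxS =>
    hu (hS x (hmem hx) hxS ▸ hx)
  have h := matchingNumber_isolate_add_le_of_isPath (S := {x | x ∈ p.support})
    (p.tail.dropLast.transfer _ hedges) (hpath.dropLast.transfer hedges)
    fun x hx => hmem (by rwa [Walk.support_transfer] at hx)
  rw [isolate_isolate, Walk.length_transfer, Walk.length_dropLast, Walk.length_tail] at h
  obtain ⟨l, hl⟩ := hodd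
  lia

lemma IsCycleUnion.matchingNumber_le_isolate (hH : IsCycleUnion H) {S : Set V}
    (hodd : ∀ ⦃u : V⦄ (p : H.Walk u u), p.IsCycle → Odd p.length)
    (hS : ∀ ⦃u : V⦄ (p : H.Walk u u), p.IsCycle →
      ∀ x ∈ p.support, x ∈ S → ∀ y ∈ p.support, y ∈ S → x = y) :
    H.matchingNumber ≤ (isolate H S).matchingNumber := by
  classical
  induction H using WellFoundedLT.induction with | ind H ih
  rcases eq_or_ne H ⊥ with rfl | hne
  · simp [matchingNumber_bot]
  obtain ⟨u, p, hp, hbase⟩ : ∃ (u : V) (p : H.Walk u u), p.IsCycle ∧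
      ∀ x ∈ p.support, x ∈ S → x = u := by
    obtain ⟨v, q, hq⟩ := hH.exists_isCycle hne
    by_cases hx : ∃ x ∈ q.support, x ∈ S
    · obtain ⟨x, hxq, hxS⟩ := hx
      have hp := (Walk.isCycle_rotate hxq).2 hq
      exact ⟨x, _, hp, fun y hy hyS => hS _ hp y hy hyS x (Walk.start_mem_support _) hxS⟩
    · push Not at hx
      exact ⟨v, q, hq, fun x hxq hxS => absurd hxS (hx x hxq)⟩
  have hle : isolate H {x | x ∈ p.support} ≤ H := isolate_le _
  have hrest := ih _ (isolate_lt (p.adj_snd hp.not_nil) p.start_mem_support)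
    (hH.isolate_support hp)
    (fun v q hq => by simpa using hodd (q.mapLe hle) ((Walk.isCycle_mapLe hle).2 hq))
    (fun v q hq => by simpa using hS (q.mapLe hle) ((Walk.isCycle_mapLe hle).2 hq))
  have hmatch := (hH.isIsolatedCycle hp).matchingNumber_le
  have hpath := matchingNumber_isolate_support_add_le_of_odd hp (hodd p hp) hbase
  rw [isolate_isolate, Set.union_comm] at hrest
  lia

lemma exists_isMatchingSet_injOn_cycleClass (G : SimpleGraph V) :
    ∃ N : Finset (Sym2 V), IsMatchingSet G N ∧ N.card = G.contractCycles.matchingNumber ∧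
      Set.InjOn (cycleClass G) {v | ∃ e ∈ N, v ∈ e} := by
  classical
  obtain ⟨M, hM, hcard⟩ := exists_isMatchingSet_card_eq G.contractCycles
  have hlift : Set.SurjOn (Sym2.map (cycleClass G)) G.edgeSet M := by
    rintro ⟨X, Y⟩ hXY
    obtain ⟨a, b, hab, -, rfl, rfl⟩ := contractCycles_adj.1 (hM.1 _ hXY)
    exact ⟨s(a, b), hab, rfl⟩
  obtain ⟨N, hNG, hinj, himage⟩ := Finset.exists_subset_injOn_image_eq_of_surjOn _ _ hlift
  have hmem {e : Sym2 V} (he : e ∈ N) : e.map (cycleClass G) ∈ M :=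
    himage ▸ Finset.mem_image_of_mem _ he
  have hedge {e f : Sym2 V} (he : e ∈ N) (hf : f ∈ N) {v w : V} (hv : v ∈ e) (hw : w ∈ f)
      (hvw : cycleClass G v = cycleClass G w) : e = f :=
    hinj he hf (hM.2 _ (hmem he) _ (hmem hf) (cycleClass G v) (Sym2.mem_map.2 ⟨v, hv, rfl⟩)
      (Sym2.mem_map.2 ⟨w, hw, hvw.symm⟩))
  refine ⟨N, ⟨hNG, fun e he f hf v hve hvf => hedge he hf hve hvf rfl⟩, ?_, ?_⟩
  · rw [← hcard, ← himage, Finset.card_image_of_injOn hinj]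
  · rintro v ⟨e, he, hve⟩ w ⟨f, hf, hwf⟩ hvw
    obtain rfl := hedge he hf hve hwf hvw
    obtain ⟨x, rfl⟩ := Sym2.mem_iff_exists.1 hve
    have hadj : G.contractCycles.Adj (cycleClass G v) (cycleClass G x) := hM.1 _ (hmem he)
    exact (Sym2.mem_iff.1 hwf).elim Eq.symm fun hwx => absurd (hwx ▸ hvw) hadj.ne

lemma matchingNumber_contractCycles_add_le (hG : G.DisjointCycles)
    (hodd : ∀ ⦃u : V⦄ (p : G.Walk u u), p.IsCycle → Odd p.length) :
    G.contractCycles.matchingNumber + (cyclePart G).matchingNumber ≤ G.matchingNumber := by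
  obtain ⟨N, hN, hcard, hinj⟩ := exists_isMatchingSet_injOn_cycleClass G
  have hle : cyclePart G ≤ G := cyclePart_le
  have hextend := hN.matchingNumber_isolate_add_card_le (S := {v | ∃ e ∈ N, v ∈ e})
    fun e he v hv => ⟨e, he, hv⟩
  have hcyc := (isCycleUnion_cyclePart hG).matchingNumber_le_isolate (S := {v | ∃ e ∈ N, v ∈ e})
    (fun u p hp => by simpa using hodd (p.mapLe hle) ((Walk.isCycle_mapLe hle).2 hp))
    fun u p hp x hx hxS y hy hyS => hinj hxS hyS
      (cycleClass_eq_of_mem_support ((Walk.isCycle_mapLe hle).2 hp) (by simpa using hx)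
        (by simpa using hy))
  have hmono := matchingNumber_mono (isolate_mono hle (subset_refl {v | ∃ e ∈ N, v ∈ e}))
  lia

end ContractionMatchings

section Extremality

variable {V : Type*} {G : SimpleGraph V} {B : Matrix V V ℂ} {S : Set V} {u v w x y : V}
  {p : G.Walk u u} {q : G.Walk v v}

lemma isTypeDWalk_of_allTypeD_isolate (hD : AllTypeD (isolate G S) B) (hp : p.IsCycle)
    (hpS : ∀ x ∈ p.support, x ∉ S) : IsTypeDWalk B p :=
  (isTypeDWalk_congr (Walk.support_transfer p _)).1
    (hD _ (hp.transfer (edges_subset_edgeSet_isolate p hpS)))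

lemma mem_cycleVerts_isolate (hp : p.IsCycle) (hpS : ∀ x ∈ p.support, x ∉ S)
    (hx : x ∈ p.support) : x ∈ (isolate G S).cycleVerts :=
  mem_cycleVerts_iff.2 ⟨u, _, hp.transfer (edges_subset_edgeSet_isolate p hpS),
    by rwa [Walk.support_transfer]⟩

lemma support_subset_of_mem_support (hG : G.DisjointCycles) (hp : p.IsCycle) (hq : q.IsCycle)
    (hxp : x ∈ p.support) (hxq : x ∈ q.support) : ∀ z ∈ p.support, z ∈ q.support :=
  support_subset_of_edges_subset hp (disjointCycles_iff.1 hG p q hp hq x hxp hxq)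

lemma IsIsolatedCycle.of_mem_support (hp : IsIsolatedCycle p) (hG : G.DisjointCycles)
    (hq : q.IsCycle) (hxp : x ∈ p.support) (hxq : x ∈ q.support) : IsIsolatedCycle q :=
  ⟨hq, fun a ha b hab => disjointCycles_iff.1 hG p q hp.isCycle hq x hxp hxq _
    (hp.mem_edges a (support_subset_of_mem_support hG hq hp.isCycle hxq hxp a ha) b hab)⟩

lemma matchingNumber_isolate_support_add_le [Finite V] (hp : p.IsCycle) :
    (isolate G {x | x ∈ p.support}).matchingNumber + p.length / 2 ≤ G.matchingNumber := by
  have hlen := Walk.length_tail_add_one hp.not_nil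
  rw [← hlen]
  exact matchingNumber_isolate_add_le_of_isPath p.tail hp.isPath_tail fun x hx =>
    Walk.cons_support_tail hp.not_nil ▸ List.mem_cons_of_mem u hx

lemma IsLeafCycle.matchingNumber_isolate_add_le [Finite V] (hp : IsLeafCycle p w) :
    (isolate G ({w} ∪ {x | x ∈ p.support})).matchingNumber + (p.length + 1) / 2 ≤
      G.matchingNumber := by
  have hnil := hp.isCycle.not_nil
  have hmem {x : V} (hx : x ∈ p.dropLast.support) : x ∈ p.support :=
    Walk.support_dropLast_concat hnil ▸ List.mem_append_left _ hx
  have h := matchingNumber_isolate_add_le_of_isPath (S := {w} ∪ {x | x ∈ p.support})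
    (.cons hp.adj.symm p.dropLast)
    (hp.isCycle.isPath_dropLast.cons fun hw => hp.notMem (hmem hw)) fun x hx => by
      rcases List.mem_cons.1 (Walk.support_cons _ _ ▸ hx) with rfl | hx
      · exact Or.inl rfl
      · exact Or.inr (hmem hx)
  rwa [Walk.length_cons, Walk.length_dropLast_add_one hnil] at h

/-- All cycles are of Type D, and a maximum matching can be assembled from one of the cycles and
one of the graph outside the cycles: the inductive form of the conditions on an extremal graph. -/
def IsCyclewise (G : SimpleGraph V) (B : Matrix V V ℂ) : Prop :=
  AllTypeD G B ∧
    G.matchingNumber ≤ (cyclePart G).matchingNumber + (isolate G G.cycleVerts).matchingNumber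

lemma isCyclewise_of_isolate_support [Finite V] (hG : G.DisjointCycles) (hp : p.IsCycle)
    (hmatch : G.matchingNumber ≤
      (isolate G {x | x ∈ p.support}).matchingNumber + p.length / 2)
    (hmeet : ∀ ⦃v : V⦄ (q : G.Walk v v), q.IsCycle → ∀ x ∈ q.support, x ∈ p.support →
      IsTypeDWalk B q)
    (hrest : IsCyclewise (isolate G {x | x ∈ p.support}) B) : IsCyclewise G B := by
  obtain ⟨hD, hrest⟩ := hrest
  refine ⟨fun v q hq => ?_, ?_⟩
  · by_cases h : ∃ x ∈ q.support, x ∈ p.support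
    · obtain ⟨x, hxq, hxp⟩ := h
      exact hmeet q hq x hxq hxp
    · push Not at h
      exact isTypeDWalk_of_allTypeD_isolate hD hq h
  have hpe := edges_subset_edgeSet_cyclePart hp
  have hcyc := matchingNumber_isolate_support_add_le (hp.transfer hpe)
  rw [Walk.support_transfer, Walk.length_transfer] at hcyc
  have hcyc_mono : cyclePart (isolate G {x | x ∈ p.support}) ≤
      isolate (cyclePart G) {x | x ∈ p.support} := fun a b hab =>
    ⟨cyclePart_mono (isolate_le _) hab, (cyclePart_le hab).2⟩
  have hO : G.cycleVerts ⊆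
      {x | x ∈ p.support} ∪ (isolate G {x | x ∈ p.support}).cycleVerts := by
    intro z hz
    obtain ⟨v, q, hq, hzq⟩ := mem_cycleVerts_iff.1 hz
    by_cases hzp : z ∈ p.support
    · exact Or.inl hzp
    · exact Or.inr (mem_cycleVerts_isolate hq
        (fun x hxq hxp => hzp (support_subset_of_mem_support hG hq hp hxq hxp z hzq)) hzq)
  rw [isolate_isolate] at hrest
  have houter := matchingNumber_mono (isolate_mono (le_refl G) hO)
  have := matchingNumber_mono hcyc_mono
  lia

variable [Fintype V]

lemma IsPendantCycle.odd_length_and_attainsBound (hp : IsPendantCycle p) (hB : IsUnitWeight G B)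
    (hG : AttainsBound G B) :
    Odd p.length ∧ AttainsBound (isolate G {x | x ∈ p.support}) B ∧
      G.matchingNumber = (isolate G {x | x ∈ p.support}).matchingNumber + p.length / 2 := by
  have hneg := weightNegIndex_le_isolate_singleton_add_one (H := G) (B := B) u
  rw [hp.weightNegIndex_isolate_singleton_eq hB] at hneg
  have hbound := weightNegIndex_le_matchingNumber_add_cyclomaticNumber (B := B)
    (isolate G {x | x ∈ p.support})
  have hcyclomatic := cyclomaticNumber_isolate_add_one_le hp.isCycle p.start_mem_support
    (S := {x | x ∈ p.support}) p.start_mem_support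
  have hmatch := matchingNumber_isolate_support_add_le hp.isCycle
  have hlen := hp.isCycle.three_le_length
  unfold AttainsBound at hG ⊢
  rw [Nat.odd_iff]
  lia

lemma IsIsolatedCycle.isTypeDWalk (hp : IsIsolatedCycle p) (hB : IsUnitWeight G B)
    (hG : AttainsBound G B) : IsTypeDWalk B p := by
  by_contra hD
  obtain ⟨hodd, -, -⟩ := hp.isPendantCycle.odd_length_and_attainsBound hB hG
  have hneg := hp.weightNegIndex_le_isolate_add hB hodd hD
  have hbound := weightNegIndex_le_matchingNumber_add_cyclomaticNumber (B := B)
    (isolate G {x | x ∈ p.support})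
  have hcyclomatic := cyclomaticNumber_isolate_add_one_le hp.isCycle p.start_mem_support
    (S := {x | x ∈ p.support}) p.start_mem_support
  have hmatch := matchingNumber_isolate_support_add_le hp.isCycle
  unfold AttainsBound at hG
  lia

/-- Deleting the outer end `w` of the edge leaving the cycle costs an edge of the matching, since
a near perfect matching of the odd cycle can be chosen to miss `u`. -/
lemma IsLeafCycle.isTypeDWalk (hp : IsLeafCycle p w) (hB : IsUnitWeight G B)
    (hG : AttainsBound G B) (hq : q.IsCycle) (hxp : x ∈ p.support) (hxq : x ∈ q.support) :
    IsTypeDWalk B q := by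
  have hdisj := hG.disjointCycles
  have hedges {v : V} {q : G.Walk v v} (h : ∀ x ∈ q.support, x ∈ p.support) :=
    edges_subset_edgeSet_isolate q (S := {w}) fun x hx hxw => hp.notMem (hxw ▸ h x hx)
  have hpe := hedges (q := p) fun _ hx => hx
  have hqe := hedges (support_subset_of_mem_support hdisj hq hp.isCycle hxq hxp)
  have hiso : IsIsolatedCycle (p.transfer _ hpe) := by
    refine ⟨hp.isCycle.transfer hpe, fun a ha b hab => ?_⟩
    rw [Walk.support_transfer] at ha
    rw [Walk.edges_transfer]
    exact (hp.mem_edges a ha b hab.1).resolve_right fun h => hab.2.2 h.2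
  obtain ⟨⟨l, hl⟩, -, -⟩ := hp.isPendantCycle.odd_length_and_attainsBound hB hG
  have hmatch := hiso.matchingNumber_le
  rw [isolate_isolate, Walk.support_transfer, Walk.length_transfer] at hmatch
  have hmatch_leaf := hp.matchingNumber_isolate_add_le
  have hneg := weightNegIndex_le_isolate_singleton_add_one (H := G) (B := B) w
  have hcyclomatic := cyclomaticNumber_mono (isolate_le (G := G) {w})
  have hbound := weightNegIndex_le_matchingNumber_add_cyclomaticNumber (B := B) (isolate G {w})
  have hw : AttainsBound (isolate G {w}) B := by
    unfold AttainsBound at hG ⊢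
    lia
  have hqiso := hiso.of_mem_support hw.disjointCycles (hq.transfer hqe) (x := x)
    (by rwa [Walk.support_transfer]) (by rwa [Walk.support_transfer])
  exact (isTypeDWalk_congr (Walk.support_transfer q hqe)).1
    (hqiso.isTypeDWalk (hB.anti (isolate_le _)) hw)

lemma IsLeaf.attainsBound_isolate (h : IsLeaf G x y) (hG : AttainsBound G B) :
    AttainsBound (isolate G {y}) B ∧ y ∉ G.cycleVerts ∧
      G.matchingNumber = (isolate G {y}).matchingNumber + 1 := by
  have hneg := weightNegIndex_le_isolate_singleton_add_one (H := G) (B := B) y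
  have hbound := weightNegIndex_le_matchingNumber_add_cyclomaticNumber (B := B) (isolate G {y})
  have hmatch := h.matchingNumber_isolate_add_one_le
  have hcyclomatic := cyclomaticNumber_mono (isolate_le (G := G) {y})
  unfold AttainsBound at hG ⊢
  refine ⟨by lia, fun hy => ?_, by lia⟩
  obtain ⟨u, p, hp, hyp⟩ := mem_cycleVerts_iff.1 hy
  have := cyclomaticNumber_isolate_add_one_le hp hyp (Set.mem_singleton y)
  lia

lemma IsLeaf.isCyclewise (h : IsLeaf G x y) (hG : AttainsBound G B)
    (hy : IsCyclewise (isolate G {y}) B) : IsCyclewise G B := by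
  obtain ⟨-, hyO, hmatch⟩ := h.attainsBound_isolate hG
  obtain ⟨hD, hrest⟩ := hy
  have hmiss {u : V} (p : G.Walk u u) (hp : p.IsCycle) : ∀ x ∈ p.support, x ∉ ({y} : Set V) :=
    fun x hx hxy => hyO (mem_cycleVerts_iff.2 ⟨u, p, hp, Set.mem_singleton_iff.1 hxy ▸ hx⟩)
  refine ⟨fun u p hp => isTypeDWalk_of_allTypeD_isolate hD hp (hmiss p hp), ?_⟩
  have hxO : x ∉ G.cycleVerts := fun hx => by
    obtain ⟨u, p, hp, hxp⟩ := mem_cycleVerts_iff.1 hx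
    obtain ⟨z, hz⟩ := exists_mem_edges_of_isCycle hp hxp
    obtain rfl := h.2 z (p.adj_of_mem_edges hz)
    exact hyO (mem_cycleVerts_iff.2 ⟨u, p, hp, p.snd_mem_support_of_mem_edges hz⟩)
  have hleaf : IsLeaf (isolate G G.cycleVerts) x y := ⟨⟨h.1, hxO, hyO⟩, fun z hz => h.2 z hz.1⟩
  have hO : G.cycleVerts ⊆ (isolate G {y}).cycleVerts := fun z hz => by
    obtain ⟨u, p, hp, hzp⟩ := mem_cycleVerts_iff.1 hz
    exact mem_cycleVerts_isolate hp (hmiss p hp) hzp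
  have houter := hleaf.matchingNumber_isolate_add_one_le
  rw [isolate_isolate, Set.union_comm] at houter
  rw [isolate_isolate] at hrest
  have hcyc := matchingNumber_mono (cyclePart_mono (isolate_le (G := G) {y}))
  have hmono := matchingNumber_mono (isolate_mono (le_refl G) (Set.union_subset_union_right {y} hO))
  lia

theorem AttainsBound.isCyclewise (hG : AttainsBound G B) (hB : IsUnitWeight G B) :
    IsCyclewise G B := by
  induction G using WellFoundedLT.induction with | ind G ih
  rcases eq_or_ne G ⊥ with rfl | hne
  · exact ⟨fun u p hp => absurd hp (isAcyclic_bot p), by simp [matchingNumber_bot]⟩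
  have hpendant {u : V} {p : G.Walk u u} (hp : IsPendantCycle p)
      (hmeet : ∀ ⦃v : V⦄ (q : G.Walk v v), q.IsCycle → ∀ x ∈ q.support, x ∈ p.support →
        IsTypeDWalk B q) : IsCyclewise G B := by
    obtain ⟨-, hrest, hmatch⟩ := hp.odd_length_and_attainsBound hB hG
    exact isCyclewise_of_isolate_support hG.disjointCycles hp.isCycle hmatch.le hmeet
      (ih _ (isolate_lt (p.adj_snd hp.isCycle.not_nil) p.start_mem_support) hrest
        (hB.anti (isolate_le _)))
  rcases exists_isLeaf_or_isIsolatedCycle_or_isLeafCycle hG.disjointCycles hne with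
    ⟨x, y, hxy⟩ | ⟨u, p, hp⟩ | ⟨u, w, p, hp⟩
  · obtain ⟨hy, -, -⟩ := hxy.attainsBound_isolate hG
    exact hxy.isCyclewise hG
      (ih _ (isolate_lt hxy.1.symm rfl) hy (hB.anti (isolate_le _)))
  · exact hpendant hp.isPendantCycle fun v q hq x hxq hxp =>
      (hp.of_mem_support hG.disjointCycles hq hxp hxq).isTypeDWalk hB hG
  · exact hpendant hp.isPendantCycle fun v q hq x hxq hxp => hp.isTypeDWalk hB hG hq hxp hxq

theorem attainsBound_iff (hB : IsUnitWeight G B) :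
    AttainsBound G B ↔ G.DisjointCycles ∧ AllTypeD G B ∧
      G.contractCycles.matchingNumber = (isolate G G.cycleVerts).matchingNumber := by
  constructor
  · intro h
    obtain ⟨hD, hm⟩ := h.isCyclewise hB
    have hadd := matchingNumber_contractCycles_add_le h.disjointCycles fun u p hp => (hD p hp).1
    have hle := matchingNumber_isolate_cycleVerts_le G
    exact ⟨h.disjointCycles, hD, by lia⟩
  · rintro ⟨hG, hD, hm⟩
    obtain ⟨K, π, hK, hKO, hπO, hcov⟩ := exists_isMatchedSet_of_matchingNumber_le hm.le
    exact attainsBound_of_isMatchedSet hG hD hB hK hKO hπO hcov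

end Extremality

section GainMatrix

variable {V : Type*} (Φ : UnitGainGraph V)

theorem adjMatrix_of_adj {u v : V} (h : Φ.graph.Adj u v) :
    Φ.adjMatrix u v = Φ.gain ⟨(u, v), h⟩ := by
  simp [adjMatrix, h]

theorem isUnitWeight_adjMatrix : IsUnitWeight Φ.graph Φ.adjMatrix :=
  ⟨Φ.isHermitian_adjMatrix, fun u v h => by rw [Φ.adjMatrix_of_adj h, Circle.norm_coe]⟩

theorem weightMatrix_adjMatrix : weightMatrix Φ.graph Φ.adjMatrix = Φ.adjMatrix := by
  ext u v
  by_cases h : Φ.graph.Adj u v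
  · exact weightMatrix_of_adj h
  · simp [weightMatrix_of_not_adj h, adjMatrix, h]

theorem negInertia_eq_weightNegIndex [Fintype V] :
    Φ.negInertia = weightNegIndex Φ.graph Φ.adjMatrix := by
  classical
  rw [weightNegIndex, weightMatrix_adjMatrix,
    negIndex_eq_card_eigenvalues_neg Φ.isHermitian_adjMatrix, negInertia]

theorem walkGain_eq_partialGain {u v : V} (p : Φ.graph.Walk u v) :
    Φ.walkGain p = partialGain Φ.adjMatrix p p.length := by
  induction p with
  | nil => simp [walkGain, partialGain]
  | @cons u v _ h p ih =>
    have hcons : Φ.walkGain (p.cons h) = Φ.adjMatrix u v * Φ.walkGain p := by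
      rw [Φ.adjMatrix_of_adj h]
      simp [walkGain]
    rw [hcons, ih, partialGain, partialGain, Walk.length_cons, Finset.prod_range_succ', mul_comm]
    simp

theorem isTypeD_iff_isTypeDWalk {u : V} (p : Φ.graph.Walk u u) :
    Φ.IsTypeD p ↔ IsTypeDWalk Φ.adjMatrix p := by
  rw [IsTypeD, IsTypeDWalk, walkGain_eq_partialGain]

end GainMatrix

end UnitGainGraph

theorem theorem3p12_general {V : Type*} [Fintype V] (Φ : UnitGainGraph V) :
    (Φ.negInertia : ℤ) = (Φ.graph.matchingNumber : ℤ) + Φ.graph.cyclomaticNumber ↔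
      Φ.graph.DisjointCycles ∧
      (∀ (u : V) (p : Φ.graph.Walk u u), p.IsCycle → Φ.IsTypeD p) ∧
      Φ.graph.contractCycles.matchingNumber =
        (Φ.graph.induce (Φ.graph.cycleVertsᶜ : Set V)).matchingNumber := by
  rw [Φ.negInertia_eq_weightNegIndex, UnitGainGraph.matchingNumber_induce_compl]
  simp only [Φ.isTypeD_iff_isTypeDWalk]
  exact UnitGainGraph.attainsBound_iff Φ.isUnitWeight_adjMatrix

theorem theorem3p12 {V : Type*} [Fintype V] (Φ : UnitGainGraph V) (hconn : Φ.graph.Connected) :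
    (Φ.negInertia : ℤ) = (Φ.graph.matchingNumber : ℤ) + Φ.graph.cyclomaticNumber ↔
      Φ.graph.DisjointCycles ∧
      (∀ (u : V) (p : Φ.graph.Walk u u), p.IsCycle → Φ.IsTypeD p) ∧
      Φ.graph.contractCycles.matchingNumber =
        (Φ.graph.induce (Φ.graph.cycleVertsᶜ : Set V)).matchingNumber :=
  theorem3p12_general Φ
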